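/- Let $K$ be an infinite field of characteristic different from $2$, and let $W(K)$ be its Witt ring of nondegenerate symmetric bilinear forms. For $x\in K$ let $[x]\in W(K)$ be the class of the one-dimensional form $\langle x\rangle$ if $x\neq 0$, and $[0]=0$. Let $I(K)\subset W(K)$ be the ideal of classes of even-dimensional forms, and let $I^2_+(K)$ be the subgroup of $W(K)$ generated by $I^2(K)=I(K)^2$ and $\langle 1,1\rangle=[1]+[1]$. Let $\|\cdot\|$ be the word norm on $W(K)$ with respect to the generators $[a]$, $a\in K^*$ (and its restriction to $I^2_+(K)$). The Witt class $\mathsf w\in H^2(PSL(2,K);W(K))$ is the class of the cocycle $$w(\pm A,\pm B)=[-A_{21}\,(AB)_{21}\,B_{21}].$$ A flat $PSL(2,K)$-bundle $\xi_\rho$ over a closed oriented surface $\Sigma_g$ of genus $g$ is given by its monodromy $\rho\colon\pi_1(\Sigma_g)=\langle a_1,b_1,\dots,a_g,b_g\mid\prod_i[a_i,b_i]\rangle\to PSL(2,K)$, and its Witt class is $\mathsf w(\xi_\rho)=\langle\rho^*\mathsf w,[\Sigma_g]\rangle\in W(K)$, where $\rho^*\mathsf w\in H^2(\pi_1(\Sigma_g);W(K))\cong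 H^2(\Sigma_g;W(K))$ is evaluated on the fundamental class. **Theorem.** Let $g\ge 1$. (a) The Witt class of every flat $PSL(2,K)$-bundle over a closed oriented surface of genus $g$ lies in $I^2_+(K)$ and has norm $\le 4(g-1)+2$. (b) Every $q\in I^2_+(K)$ with $\|q\|\le 4(g-1)$ (whether or not $q\in I^2(K)$) is the Witt class of some flat $PSL(2,K)$-bundle over a closed oriented surface of genus $g$. -/

import Mathlib

open CategoryTheory groupCohomology
open scoped MatrixGroups

universe u

noncomputable section

/-! ### The Witt ring of a field of characteristic different from two -/

/-- The relations defining the Witt ring: two diagonal forms `⟨a₁, …, aₙ⟩` and `⟨b₁, …, bₙ⟩` that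
are isometric are identified, and the hyperbolic plane `⟨1, -1⟩` is zero. -/
def wittRelations (K : Type u) [Field K] : Set (MonoidAlgebra ℤ Kˣ) :=
  {x | ∃ (n : ℕ) (a b : Fin n → Kˣ),
      QuadraticMap.Equivalent (QuadraticMap.weightedSumSquares K a)
        (QuadraticMap.weightedSumSquares K b) ∧
      x = ∑ i, MonoidAlgebra.of ℤ Kˣ (a i) - ∑ i, MonoidAlgebra.of ℤ Kˣ (b i)} ∪
    {MonoidAlgebra.of ℤ Kˣ 1 + MonoidAlgebra.of ℤ Kˣ (-1)}

/-- The Witt ring `W(K)`: the Grothendieck ring of isometry classes of nondegenerate quadratic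
(equivalently, symmetric bilinear) forms over `K`, modulo the hyperbolic plane. In characteristic
`≠ 2` every such form is diagonal, orthogonal sum is concatenation of diagonals and
`⟨a⟩ ⊗ ⟨b⟩ = ⟨a b⟩`, so this is the group ring `ℤ[Kˣ]` modulo isometry of diagonal forms and
`⟨1, -1⟩ = 0`. -/
def WittRing (K : Type u) [Field K] : Type u :=
  MonoidAlgebra ℤ Kˣ ⧸ Ideal.span (wittRelations K)

instance (K : Type u) [Field K] : CommRing (WittRing K) :=
  inferInstanceAs (CommRing (MonoidAlgebra ℤ Kˣ ⧸ Ideal.span (wittRelations K)))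

namespace WittRing

variable {K : Type u} [Field K]

/-- The quotient map from the group ring. -/
def mk (K : Type u) [Field K] : MonoidAlgebra ℤ Kˣ →+* WittRing K :=
  Ideal.Quotient.mk (Ideal.span (wittRelations K))

theorem mk_surjective : Function.Surjective (mk K) := Ideal.Quotient.mk_surjective

/-- The class `[a]` of the one-dimensional form `⟨a⟩`, for `a ∈ Kˣ`. -/
def unitClass (a : Kˣ) : WittRing K := mk K (MonoidAlgebra.of ℤ Kˣ a)

open Classical in
/-- The class `[x]` of the one-dimensional symmetric bilinear space with form `x`,
the degenerate form `[0]` being zero. -/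
def bracket (x : K) : WittRing K := if h : x = 0 then 0 else unitClass (Units.mk0 x h)

/-- The dimension modulo two, a ring homomorphism on the Witt ring. -/
def dimModTwo (K : Type u) [Field K] : WittRing K →+* ZMod 2 :=
  Ideal.Quotient.lift (Ideal.span (wittRelations K))
    (MonoidAlgebra.lift ℤ (ZMod 2) Kˣ 1).toRingHom (by
      intro x hx
      rw [← RingHom.mem_ker]
      refine (Ideal.span_le.mpr ?_) hx
      rintro y (⟨n, a, b, -, rfl⟩ | rfl)
      · simp
      · simp only [SetLike.mem_coe, RingHom.mem_ker, map_add]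
        simp
        decide)

/-- The fundamental ideal `I(K)` of classes of even-dimensional forms. -/
def fundamentalIdeal (K : Type u) [Field K] : Ideal (WittRing K) := RingHom.ker (dimModTwo K)

/-- The subgroup `I²₊(K)` of `W(K)` generated by `I²(K)` and `⟨1, 1⟩`. -/
def iSqPlus (K : Type u) [Field K] : AddSubgroup (WittRing K) :=
  AddSubgroup.closure
    (((fundamentalIdeal K ^ 2 : Ideal (WittRing K)) : Set (WittRing K)) ∪
      {unitClass 1 + unitClass 1})

/-- `x` is a word of length `n` in the generators `[a]`, `a ∈ Kˣ`, and their inverses. -/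
def IsWordOfLength (x : WittRing K) (n : ℕ) : Prop :=
  ∃ (ε : Fin n → ℤˣ) (a : Fin n → Kˣ), x = ∑ i, (ε i : ℤ) • unitClass (a i)

/-- The norm on `W(K)`: the word norm with respect to the generators `[a]`, `a ∈ Kˣ`. -/
def wittNorm (x : WittRing K) : ℕ := sInf {n | IsWordOfLength x n}

theorem IsWordOfLength.add {x y : WittRing K} {m n : ℕ} (hx : IsWordOfLength x m)
    (hy : IsWordOfLength y n) : IsWordOfLength (x + y) (m + n) := by
  obtain ⟨ε, a, rfl⟩ := hx
  obtain ⟨η, b, rfl⟩ := hy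
  exact ⟨Fin.append ε η, Fin.append a b, by simp [Fin.sum_univ_add]⟩

/-- Every element of the Witt ring is a word in the generators, so that the infimum defining the
norm is a minimum. -/
theorem exists_isWordOfLength (x : WittRing K) : ∃ n, IsWordOfLength x n := by
  obtain ⟨f, rfl⟩ := mk_surjective x
  have hz : IsWordOfLength (0 : WittRing K) 0 := ⟨Fin.elim0, Fin.elim0, by simp⟩
  have h1 : ∀ (a : Kˣ) (e : ℤˣ), IsWordOfLength ((e : ℤ) • unitClass a) 1 := fun a e =>
    ⟨fun _ => e, fun _ => a, by simp⟩
  induction f using MonoidAlgebra.induction_on with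
  | of a => exact ⟨1, by simpa [unitClass] using h1 a 1⟩
  | add f g hf hg =>
    obtain ⟨m, hm⟩ := hf
    obtain ⟨n, hn⟩ := hg
    exact ⟨m + n, by rw [map_add]; exact hm.add hn⟩
  | smul r f hf =>
    obtain ⟨m, hm⟩ := hf
    rw [map_zsmul]
    have hneg : ∀ {y : WittRing K} {k : ℕ}, IsWordOfLength y k → IsWordOfLength (-y) k := by
      rintro y k ⟨ε, a, rfl⟩
      exact ⟨fun i => -ε i, a, by simp⟩
    induction r using Int.induction_on with
    | zero => exact ⟨0, by simpa using hz⟩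
    | succ i ih =>
      obtain ⟨k, hk⟩ := ih
      exact ⟨k + m, by rw [add_smul, one_smul]; exact hk.add hm⟩
    | pred i ih =>
      obtain ⟨k, hk⟩ := ih
      exact ⟨k + m, by rw [sub_smul, one_smul, sub_eq_add_neg]; exact hk.add (hneg hm)⟩

/-! Relations needed for the cocycle identity. -/

theorem sum_unitClass_eq {n : ℕ} (a b : Fin n → Kˣ)
    (h : QuadraticMap.Equivalent (QuadraticMap.weightedSumSquares K a)
        (QuadraticMap.weightedSumSquares K b)) :
    ∑ i, unitClass (a i) = ∑ i, unitClass (b i) := by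
  have := (Ideal.Quotient.eq (I := Ideal.span (wittRelations K))).mpr
    (Ideal.subset_span (Or.inl ⟨n, a, b, h, rfl⟩))
  change mk K _ = mk K _ at this
  simpa only [map_sum, unitClass] using this

@[simp] theorem bracket_zero : bracket (0 : K) = 0 := by simp [bracket]

theorem bracket_of_ne {x : K} (h : x ≠ 0) : bracket x = unitClass (Units.mk0 x h) := by
  simp [bracket, h]

theorem bracket_mul_sq (x : K) {y : K} (hy : y ≠ 0) : bracket (x * y ^ 2) = bracket x := by
  by_cases hx : x = 0
  · simp [hx]
  have hxy : x * y ^ 2 ≠ 0 := mul_ne_zero hx (pow_ne_zero _ hy)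
  rw [bracket_of_ne hx, bracket_of_ne hxy]
  have := sum_unitClass_eq (fun _ : Fin 1 => Units.mk0 _ hxy) (fun _ : Fin 1 => Units.mk0 x hx)
    ⟨QuadraticForm.isometryEquivWeightedSumSquaresWeightedSumSquares
      (fun _ => toUnits (Units.mk0 y hy)) (fun _ => by ext; simp)⟩
  simpa using this

theorem bracket_add_neg (x : K) : bracket x + bracket (-x) = 0 := by
  by_cases hx : x = 0
  · simp [hx]
  have hnx : -x ≠ 0 := neg_ne_zero.mpr hx
  have h1 : unitClass (1 : Kˣ) + unitClass (-1 : Kˣ) = 0 := by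
    have : mk K (MonoidAlgebra.of ℤ Kˣ 1 + MonoidAlgebra.of ℤ Kˣ (-1)) = 0 :=
      Ideal.Quotient.eq_zero_iff_mem.mpr (Ideal.subset_span (Or.inr rfl))
    rw [map_add] at this
    exact this
  have hmul : ∀ a b : Kˣ, unitClass (a * b) = unitClass a * unitClass b := fun a b => by
    simp only [unitClass, map_mul]
  have := congrArg (unitClass (Units.mk0 x hx) * ·) h1
  simp only [mul_add, ← hmul, mul_zero] at this
  rw [bracket_of_ne hx, bracket_of_ne hnx, ← this]
  congr 2
  · simp
  · ext; simp

/-- The Witt relation, valid also in degenerate cases. -/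
theorem bracket_add (a b : K) :
    bracket a + bracket b = bracket (a + b) + bracket (a * b * (a + b)) := by
  by_cases ha : a = 0
  · simp [ha]
  by_cases hb : b = 0
  · simp [hb]
  by_cases hab : a + b = 0
  · obtain rfl : b = -a := by linear_combination hab
    simp [bracket_add_neg]
  have hc : a * b * (a + b) ≠ 0 := mul_ne_zero (mul_ne_zero ha hb) hab
  rw [bracket_of_ne ha, bracket_of_ne hb, bracket_of_ne hab, bracket_of_ne hc]
  have := sum_unitClass_eq ![Units.mk0 _ hab, Units.mk0 _ hc] ![Units.mk0 a ha, Units.mk0 b hb] ?_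
  · simpa using this.symm
  refine ⟨⟨LinearEquiv.ofLinearMap
    (Matrix.toLin' !![1, b; 1, -a])
    (Matrix.toLin' !![a / (a + b), b / (a + b); 1 / (a + b), -1 / (a + b)]) ?_ ?_, ?_⟩⟩
  · rw [← Matrix.toLin'_mul, ← Matrix.toLin'_one]
    congr 1
    ext i j
    fin_cases i <;> fin_cases j <;> simp [Matrix.mul_apply, Fin.sum_univ_two] <;> field_simp <;> ring
  · rw [← Matrix.toLin'_mul, ← Matrix.toLin'_one]
    congr 1
    ext i j
    fin_cases i <;> fin_cases j <;> simp [Matrix.mul_apply, Fin.sum_univ_two] <;> field_simp <;> ring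
  · intro v
    simp [QuadraticMap.weightedSumSquares_apply, Fin.sum_univ_two, Units.smul_def,
      Matrix.toLin'_apply, dotProduct]
    ring

end WittRing

open WittRing

/-! ### The Witt cocycle and the Witt class of `PSL(2, K)` -/

/-- The Witt cocycle `w(±A, ±B) = [-A₂₁ (AB)₂₁ B₂₁]`. -/
def wittCocycleFun (K : Type u) [Field K] (p q : PSL(2, K)) : WittRing K :=
  Quotient.liftOn₂' p q
    (fun A B : SL(2, K) => bracket (-(A.1 1 0 * (A * B).1 1 0 * B.1 1 0)))
    (by
      intro A B A' B' hA hB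
      rw [QuotientGroup.leftRel_apply, Matrix.SpecialLinearGroup.mem_center_iff] at hA hB
      obtain ⟨r, hr, hrA⟩ := hA
      obtain ⟨s, hs, hsB⟩ := hB
      simp only [Fintype.card_fin] at hr hs
      have eA : A'.1 = r • A.1 := by
        have : A' = A * (A⁻¹ * A') := by group
        rw [this, Matrix.SpecialLinearGroup.coe_mul, ← hrA]
        ext i j; simp [mul_comm]
      have eB : B'.1 = s • B.1 := by
        have : B' = B * (B⁻¹ * B') := by group
        rw [this, Matrix.SpecialLinearGroup.coe_mul, ← hsB]
        ext i j; simp [mul_comm]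
      simp only [Matrix.SpecialLinearGroup.coe_mul, eA, eB, Matrix.smul_apply, smul_eq_mul,
        Matrix.smul_mul, Matrix.mul_smul]
      congr 2
      linear_combination (-(A.1 1 0 * (A.1 * B.1) 1 0 * B.1 1 0)) * (s ^ 2 * hr + hs))

theorem wittCocycleFun_mk {K : Type u} [Field K] (A B : SL(2, K)) :
    wittCocycleFun K (A : PSL(2, K)) (B : PSL(2, K)) =
      bracket (-(A.1 1 0 * (A * B).1 1 0 * B.1 1 0)) := rfl

theorem bracket_cocycle {K : Type u} [Field K] (a b c d e f : K)
    (h : a * f - b * e + c * d = 0)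
    (h0 : a = 0 → ∃ t ≠ 0, d = t * b ∧ e = t * c)
    (h1 : d = 0 → ∃ t ≠ 0, b = t * a ∧ f = t * e)
    (h2 : e = 0 → ∃ t ≠ 0, f = -t * d ∧ c = t * a) :
    bracket (-(b * c * f)) + bracket (-(a * b * d)) =
      bracket (-(d * e * f)) + bracket (-(a * c * e)) := by
  by_cases ha : a = 0
  · obtain ⟨t, ht, rfl, rfl⟩ := h0 ha
    rw [ha, ← bracket_mul_sq (-(b * c * f)) ht]
    simp only [zero_mul, neg_zero, bracket_zero, add_zero]
    congr 1; ring
  by_cases hd : d = 0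
  · obtain ⟨t, ht, rfl, rfl⟩ := h1 hd
    rw [hd, ← bracket_mul_sq (-(a * c * e)) ht]
    simp only [mul_zero, zero_mul, neg_zero, bracket_zero, add_zero, zero_add]
    congr 1; ring
  by_cases he : e = 0
  · obtain ⟨t, ht, rfl, rfl⟩ := h2 he
    have : -(b * (t * a) * (-t * d)) = (a * b * d) * t ^ 2 := by ring
    rw [this, bracket_mul_sq _ ht, he]
    simp [bracket_add_neg]
  have key := bracket_add (-(d * e * a) * (a * f)) (-(d * e * a) * (c * d))
  have e1 : -(d * e * a) * (a * f) = -(d * e * f) * a ^ 2 := by ring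
  have e2 : -(d * e * a) * (c * d) = -(a * c * e) * d ^ 2 := by ring
  have e3 : -(d * e * a) * (a * f) + -(d * e * a) * (c * d) = -(a * b * d) * e ^ 2 := by
    linear_combination (-(d * e * a)) * h
  have e4 : -(d * e * a) * (a * f) * (-(d * e * a) * (c * d)) *
      (-(d * e * a) * (a * f) + -(d * e * a) * (c * d)) =
      -(b * c * f) * (d ^ 2 * e ^ 2 * a ^ 2) ^ 2 := by
    rw [e3]; ring
  rw [e4, e3, e1, e2, bracket_mul_sq _ ha, bracket_mul_sq _ hd, bracket_mul_sq _ he,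
    bracket_mul_sq _ (mul_ne_zero (mul_ne_zero (pow_ne_zero _ hd) (pow_ne_zero _ he))
      (pow_ne_zero _ ha))] at key
  rw [key, add_comm]

/-- The cocycle identity for the Witt cocycle. -/
theorem wittCocycleFun_cocycle {K : Type u} [Field K] (p q r : PSL(2, K)) :
    wittCocycleFun K (p * q) r + wittCocycleFun K p q =
      wittCocycleFun K q r + wittCocycleFun K p (q * r) := by
  induction p using QuotientGroup.induction_on with | _ A
  induction q using QuotientGroup.induction_on with | _ B
  induction r using QuotientGroup.induction_on with | _ C
  simp only [← QuotientGroup.mk_mul, wittCocycleFun_mk]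
  have hA := A.2
  have hB := B.2
  have hC := C.2
  rw [Matrix.det_fin_two] at hA hB hC
  have key := bracket_cocycle (A.1 1 0) ((A * B).1 1 0) ((A * B * C).1 1 0)
    (B.1 1 0) ((B * C).1 1 0) (C.1 1 0) ?_ ?_ ?_ ?_
  · rw [← mul_assoc]
    convert key using 4
  all_goals
    simp only [Matrix.SpecialLinearGroup.coe_mul, Matrix.mul_apply, Fin.sum_univ_two]
  · linear_combination (-(C.1 1 0 * A.1 1 0)) * hB
  · intro h
    have hA' : A.1 0 0 * A.1 1 1 = 1 := by linear_combination hA + A.1 0 1 * h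
    refine ⟨A.1 0 0, left_ne_zero_of_mul_eq_one hA', ?_, ?_⟩
    · linear_combination (-B.1 1 0) * hA' - A.1 0 0 * B.1 0 0 * h
    · linear_combination (-(B.1 1 0 * C.1 0 0 + B.1 1 1 * C.1 1 0)) * hA' -
        A.1 0 0 * (B.1 0 0 * C.1 0 0 + B.1 0 1 * C.1 1 0) * h
  · intro h
    have hB' : B.1 0 0 * B.1 1 1 = 1 := by linear_combination hB + B.1 0 1 * h
    refine ⟨B.1 0 0, left_ne_zero_of_mul_eq_one hB', ?_, ?_⟩
    · linear_combination A.1 1 1 * h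
    · linear_combination (-C.1 1 0) * hB' - B.1 0 0 * C.1 0 0 * h
  · intro h
    have hD : (B.1 0 0 * C.1 0 0 + B.1 0 1 * C.1 1 0) * (B.1 1 0 * C.1 0 1 + B.1 1 1 * C.1 1 1) -
        (B.1 0 0 * C.1 0 1 + B.1 0 1 * C.1 1 1) * (B.1 1 0 * C.1 0 0 + B.1 1 1 * C.1 1 0) = 1 := by
      linear_combination (C.1 0 0 * C.1 1 1 - C.1 0 1 * C.1 1 0) * hB + hC
    have hD' : (B.1 0 0 * C.1 0 0 + B.1 0 1 * C.1 1 0) *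
        (B.1 1 0 * C.1 0 1 + B.1 1 1 * C.1 1 1) = 1 := by
      linear_combination hD + (B.1 0 0 * C.1 0 1 + B.1 0 1 * C.1 1 1) * h
    refine ⟨B.1 0 0 * C.1 0 0 + B.1 0 1 * C.1 1 0, left_ne_zero_of_mul_eq_one hD', ?_, ?_⟩
    · linear_combination (B.1 0 0 * C.1 0 0 + B.1 0 1 * C.1 1 0) * C.1 1 1 * h - C.1 1 0 * hD' -
        (B.1 0 0 * C.1 0 0 + B.1 0 1 * C.1 1 0) * B.1 1 0 * hC
    · linear_combination A.1 1 1 * h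

/-- The Witt cocycle as a 2-cocycle with values in the trivial module `W(K)`. -/
def wittCocycle (K : Type u) [Field K] :
    cocycles₂ (Rep.trivial (WittRing K) PSL(2, K) (WittRing K)) :=
  ⟨fun p => wittCocycleFun K p.1 p.2, by
    rw [mem_cocycles₂_iff]
    intro g h j
    simpa using wittCocycleFun_cocycle g h j⟩

/-- The Witt class in `H²(PSL(2, K); W(K))`. -/
def wittClass (K : Type u) [Field K] :
    H2 (Rep.trivial (WittRing K) PSL(2, K) (WittRing K)) :=
  H2π _ (wittCocycle K)

/-! ### Surface groups and evaluation on the fundamental class -/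

/-- The standard generators `a₁, b₁, …, a_g, b_g` of the fundamental group of a closed oriented
surface of genus `g`. -/
inductive SurfaceGenerator (g : ℕ) : Type u
  | a (i : Fin g) : SurfaceGenerator g
  | b (i : Fin g) : SurfaceGenerator g

/-- The standard relator `[a₁, b₁] ⋯ [a_g, b_g]`. -/
def surfaceRelator (g : ℕ) : FreeGroup (SurfaceGenerator.{u} g) :=
  (List.ofFn fun i : Fin g =>
    FreeGroup.of (SurfaceGenerator.a i) * FreeGroup.of (SurfaceGenerator.b i) *
      (FreeGroup.of (SurfaceGenerator.a i))⁻¹ * (FreeGroup.of (SurfaceGenerator.b i))⁻¹).prod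

/-- The fundamental group `π₁(Σ_g) = ⟨a₁, b₁, …, a_g, b_g | [a₁, b₁] ⋯ [a_g, b_g]⟩` of the closed
oriented surface of genus `g`. -/
abbrev SurfaceGroup (g : ℕ) : Type u := PresentedGroup {surfaceRelator.{u} g}

/-- The generator `a_i` of the surface group. -/
def surfaceA (g : ℕ) (i : Fin g) : SurfaceGroup.{u} g := PresentedGroup.of (SurfaceGenerator.a i)

/-- The generator `b_i` of the surface group. -/
def surfaceB (g : ℕ) (i : Fin g) : SurfaceGroup.{u} g := PresentedGroup.of (SurfaceGenerator.b i)

/-- The word `a₁ b₁ a₁⁻¹ b₁⁻¹ ⋯ a_g b_g a_g⁻¹ b_g⁻¹` read along the boundary of the `4g`-gon. -/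
def surfaceWord (g : ℕ) : List (SurfaceGroup.{u} g) :=
  (List.ofFn fun i : Fin g =>
    [surfaceA g i, surfaceB g i, (surfaceA g i)⁻¹, (surfaceB g i)⁻¹]).flatten

theorem surfaceWord_prod (g : ℕ) : (surfaceWord.{u} g).prod = 1 := by
  have h := PresentedGroup.one_of_mem (rels := {surfaceRelator.{u} g}) (Set.mem_singleton _)
  have hflat : ∀ L : List (List (SurfaceGroup.{u} g)),
      L.flatten.prod = (L.map List.prod).prod := by
    intro L
    induction L with
    | nil => rfl
    | cons l L ih => rw [List.flatten_cons, List.prod_append, ih, List.map_cons, List.prod_cons]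
  refine Eq.trans ?_ ((map_list_prod (PresentedGroup.mk {surfaceRelator.{u} g})
    (List.ofFn fun i : Fin g =>
      FreeGroup.of (SurfaceGenerator.a i) * FreeGroup.of (SurfaceGenerator.b i) *
        (FreeGroup.of (SurfaceGenerator.a i))⁻¹ *
        (FreeGroup.of (SurfaceGenerator.b i))⁻¹)).symm.trans h)
  rw [surfaceWord, hflat, List.map_ofFn, List.map_ofFn]
  congr 2

/-- The Kronecker pairing of a 2-chain with 2-cochains, with trivial coefficients. -/
def chainPairing {G : Type u} (R : Type u) [CommRing R] (z : G × G →₀ ℤ) : (G × G → R) →ₗ[R] R :=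
  ∑ p ∈ z.support, z p • LinearMap.proj p

theorem chainPairing_apply {G : Type u} (R : Type u) [CommRing R] (z : G × G →₀ ℤ) (f : G × G → R) :
    chainPairing R z f = z.sum fun p n => n • f p := by
  simp [chainPairing, Finsupp.sum]

section Bar

variable {G : Type u} [Group G]

/-- The bar 2-chain `[p | s₁] + [p s₁ | s₂] + [p s₁ s₂ | s₃] + ⋯`: the triangulation of a polygon
with boundary word `s₁ s₂ s₃ ⋯` by the diagonals issuing from a vertex. -/
def barFan : G → List G → (G × G →₀ ℤ)
  | _, [] => 0
  | p, s :: l => Finsupp.single (p, s) 1 + barFan (p * s) l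

/-- The boundary of bar 2-chains with trivial coefficients, `∂[g | h] = [h] - [g h] + [g]`. -/
def barBoundary : (G × G →₀ ℤ) →+ (G →₀ ℤ) :=
  Finsupp.liftAddHom fun p => (Finsupp.singleAddHom p.2 : ℤ →+ (G →₀ ℤ)) -
    Finsupp.singleAddHom (p.1 * p.2) + Finsupp.singleAddHom p.1

theorem barBoundary_single (g h : G) (n : ℤ) :
    barBoundary (Finsupp.single (g, h) n) =
      Finsupp.single h n - Finsupp.single (g * h) n + Finsupp.single g n := by
  simp [barBoundary]

theorem barBoundary_barFan (p : G) (l : List G) :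
    barBoundary (barFan p l) =
      (l.map fun s => Finsupp.single s (1 : ℤ)).sum - Finsupp.single (p * l.prod) 1 +
        Finsupp.single p 1 := by
  induction l generalizing p with
  | nil => simp [barFan]
  | cons s l ih =>
    simp only [barFan, map_add, barBoundary_single, ih, List.map_cons, List.sum_cons,
      List.prod_cons, mul_assoc]
    abel

/-- The pairing of a coboundary with a chain is the pairing of the cochain with the boundary. -/
theorem chainPairing_coboundary (R : Type u) [CommRing R] (z : G × G →₀ ℤ) (x : G → R) :
    chainPairing R z (fun p => x p.2 - x (p.1 * p.2) + x p.1) =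
      (barBoundary z).sum fun g n => n • x g := by
  rw [chainPairing_apply]
  induction z using Finsupp.induction_linear with
  | zero => simp
  | add f g hf hg =>
    rw [map_add, Finsupp.sum_add_index' (by simp) (by intros; exact add_smul _ _ _), hf, hg,
      Finsupp.sum_add_index' (by simp) (by intros; exact add_smul _ _ _)]
  | single p n =>
    obtain ⟨g, h⟩ := p
    rw [barBoundary_single, sub_eq_add_neg, ← Finsupp.single_neg,
      Finsupp.sum_add_index' (by simp) (by intros; exact add_smul _ _ _),
      Finsupp.sum_add_index' (by simp) (by intros; exact add_smul _ _ _),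
      Finsupp.sum_single_index (by simp), Finsupp.sum_single_index (by simp),
      Finsupp.sum_single_index (by simp), Finsupp.sum_single_index (by simp)]
    simp only [smul_add, smul_sub, neg_smul]
    abel

theorem H2π_surjective (R : Type u) [CommRing R] :
    Function.Surjective (H2π (Rep.trivial R G R)).hom :=
  (ModuleCat.epi_iff_surjective _).mp inferInstance

/-- A bar 2-cycle with integer coefficients defines a linear functional on `H²`: the class of a
cocycle `c` is sent to the pairing of `c` with the cycle. -/
def evalCycle (R : Type u) [CommRing R] (z : G × G →₀ ℤ) (hz : barBoundary z = 0) :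
    H2 (Rep.trivial R G R) →ₗ[R] R :=
  (Submodule.liftQ (LinearMap.ker (H2π (Rep.trivial R G R)).hom)
    ((chainPairing R z).comp (cocycles₂ (Rep.trivial R G R)).subtype) (by
      intro c hc
      obtain ⟨x, hx⟩ := (H2π_eq_zero_iff c).mp hc
      refine LinearMap.mem_ker.mpr ?_
      have hx' : (c : G × G → R) = fun p => x p.2 - x (p.1 * p.2) + x p.1 := hx.symm
      change chainPairing R z (c : G × G → R) = 0
      rw [hx', chainPairing_coboundary, hz, Finsupp.sum_zero_index])).comp
    ((H2π (Rep.trivial R G R)).hom.quotKerEquivOfSurjective (H2π_surjective R)).symm.toLinearMap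

theorem evalCycle_H2π (R : Type u) [CommRing R] (z : G × G →₀ ℤ) (hz : barBoundary z = 0)
    (c : cocycles₂ (Rep.trivial R G R)) :
    evalCycle R z hz (H2π _ c) = z.sum fun p n => n • (c p : R) := by
  rw [← chainPairing_apply]
  have h : ((H2π (Rep.trivial R G R)).hom.quotKerEquivOfSurjective (H2π_surjective R)).symm
      (H2π (Rep.trivial R G R) c) = Submodule.Quotient.mk c := by
    rw [LinearEquiv.symm_apply_eq]
    rfl
  unfold evalCycle
  rw [LinearMap.comp_apply]
  erw [h]
  rfl

end Bar

/-- The standard bar 2-cycle representing the fundamental class in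
`H₂(Σ_g; ℤ) = H₂(π₁(Σ_g); ℤ)`: the fan triangulation of the `4g`-gon, corrected by the degenerate
terms that account for the edges traversed backwards. -/
def fundamentalCycle (g : ℕ) : SurfaceGroup.{u} g × SurfaceGroup.{u} g →₀ ℤ :=
  barFan 1 (surfaceWord g) -
    ∑ i : Fin g, (Finsupp.single (surfaceA g i, (surfaceA g i)⁻¹) 1 +
      Finsupp.single (surfaceB g i, (surfaceB g i)⁻¹) 1) -
    Finsupp.single (1, 1) (2 * g : ℤ)

theorem barBoundary_fundamentalCycle (g : ℕ) : barBoundary (fundamentalCycle.{u} g) = 0 := by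
  have hw : ((surfaceWord.{u} g).map fun s => Finsupp.single s (1 : ℤ)).sum =
      ∑ i : Fin g, (Finsupp.single (surfaceA g i) 1 + Finsupp.single (surfaceB g i) 1 +
        Finsupp.single (surfaceA g i)⁻¹ 1 + Finsupp.single (surfaceB g i)⁻¹ 1) := by
    rw [surfaceWord, List.map_flatten, List.sum_flatten, List.map_map, List.map_ofFn,
      List.sum_ofFn]
    refine Finset.sum_congr rfl fun i _ => ?_
    simp [add_assoc]
  rw [fundamentalCycle, map_sub, map_sub, barBoundary_barFan, hw, surfaceWord_prod, map_sum]
  simp only [map_add, barBoundary_single, mul_inv_cancel, mul_one, Finset.sum_add_distrib,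
    Finset.sum_sub_distrib, Finset.sum_const, Finset.card_univ, Fintype.card_fin,
    Finsupp.smul_single, nsmul_eq_mul]
  rw [two_mul, Finsupp.single_add]
  abel

/-- The isomorphism `H²(Σ_g; R) = H²(π₁(Σ_g); R) → R`, evaluation on the fundamental class. -/
def evalFundamentalClass (R : Type u) [CommRing R] (g : ℕ) :
    H2 (Rep.trivial R (SurfaceGroup.{u} g) R) →ₗ[R] R :=
  evalCycle R (fundamentalCycle g) (barBoundary_fundamentalCycle g)

/-- The Witt class `w(ξ_ρ) ∈ W(K)` of the flat `PSL(2, K)`-bundle `ξ_ρ` over the closed oriented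
surface of genus `g` with monodromy representation `ρ`: the pullback of the Witt class by `ρ`
evaluated on the fundamental class. -/
def bundleWittClass {K : Type u} [Field K] {g : ℕ} (ρ : SurfaceGroup.{u} g →* PSL(2, K)) :
    WittRing K :=
  evalFundamentalClass (WittRing K) g
    ((groupCohomology.map (A := Rep.trivial (WittRing K) PSL(2, K) (WittRing K))
      (B := Rep.trivial (WittRing K) (SurfaceGroup.{u} g) (WittRing K)) ρ (𝟙 _) 2).hom
      (wittClass K))

/-- The Witt class of a bundle as the sum of the Witt cocycle over the fundamental cycle. -/
theorem bundleWittClass_eq {K : Type u} [Field K] {g : ℕ} (ρ : SurfaceGroup.{u} g →* PSL(2, K)) :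
    bundleWittClass ρ =
      (fundamentalCycle g).sum fun p n => n • wittCocycleFun K (ρ p.1) (ρ p.2) := by
  unfold bundleWittClass wittClass evalFundamentalClass
  have h := ConcreteCategory.congr_hom
    (H2π_comp_map (A := Rep.trivial (WittRing K) PSL(2, K) (WittRing K))
      (B := Rep.trivial (WittRing K) (SurfaceGroup.{u} g) (WittRing K)) ρ (𝟙 _)) (wittCocycle K)
  erw [h]
  exact evalCycle_H2π _ _ _ _

end

open WittRing

noncomputable section

/-! ### The central extension defined by the Witt cocycle -/

section CentralExtension

variable {K : Type u} [Field K]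

/-! The Witt cocycle is normalised, so it makes `PSL(2, K) × W(K)` into a central extension
`WittExtension` in which `(p, t)` has inverse `(p⁻¹, -t)`. As in Milnor's description of Euler
classes, lift the monodromies of the generators: the product of the commutators of the lifts is `(1,
w(ξ_ρ))`, whatever the lifts. Thus the Witt classes in genus `g` are the `q` for which `(1, q)` is a
product of `g` commutators (`prod_lift_surfaceWord`, `IsCommProd.exists_bundleWittClass_eq`).

For (b), cut the surface into pieces. A one-holed torus realises the Witt coordinate `[a] + [b]`
with boundary monodromy `diag(λ, λ⁻¹)`, `λ = a b s²` (`isCommProd_torus`). A pair of pants joining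
boundaries `λ`, `λ'` adds `[a] + [b]` and has third boundary `a b λ λ' s²` (`IsCommProd.pants`). All
these monodromies are kept hyperbolic by the choice of `s`. Hence genus `n + 1` with one hole
realises any sum of `4n + 2` unit classes, its monodromy being their product up to squares. Capping
with one more torus requires the product of all the units to be a square up to sign. This holds for
`q ∈ I²₊(K)`: dimension mod 2 and discriminant modulo sign form a ring homomorphism (`discHom`) that
kills `I²(K)` and `⟨1, 1⟩`. Hyperbolic planes pad `q` to length exactly `4(g - 1)`.

For (a), the fan triangulation has `4g` triangles, two of which contribute zero, and each other one
contributes norm at most 1. Modulo `I²₊(K)` one has `[x] = 1 + d(x)`, where `d` is additive on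
products of nonzero elements and ignores squares and signs, so the cocycle becomes an explicit
coboundary (`mk_wittCocycleFun_mk`). -/

theorem WittRing.bracket_val (a : Kˣ) : bracket (a : K) = unitClass a := by
  rw [bracket_of_ne a.ne_zero, Units.mk0_val]

theorem wittCocycleFun_one_left (p : PSL(2, K)) : wittCocycleFun K 1 p = 0 := by
  induction p using QuotientGroup.induction_on with | _ A
  rw [← QuotientGroup.mk_one, wittCocycleFun_mk]
  simp

theorem wittCocycleFun_of_mul_eq_one {p q : PSL(2, K)} (h : p * q = 1) :
    wittCocycleFun K p q = 0 := by
  obtain rfl := eq_inv_of_mul_eq_one_right h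
  induction p using QuotientGroup.induction_on with | _ A
  rw [← QuotientGroup.mk_inv, wittCocycleFun_mk]
  simp

/-- The central extension of `PSL(2, K)` by `W(K)` defined by the Witt cocycle. -/
@[ext]
structure WittExtension (K : Type u) [Field K] : Type u where
  /-- The image in `PSL(2, K)`. -/
  base : PSL(2, K)
  /-- The coordinate in the Witt ring. -/
  val : WittRing K

namespace WittExtension

instance : Mul (WittExtension K) :=
  ⟨fun x y => ⟨x.base * y.base, x.val + y.val + wittCocycleFun K x.base y.base⟩⟩
instance : One (WittExtension K) := ⟨⟨1, 0⟩⟩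
instance : Inv (WittExtension K) := ⟨fun x => ⟨x.base⁻¹, -x.val⟩⟩

@[simp] theorem mul_base (x y : WittExtension K) : (x * y).base = x.base * y.base := rfl
@[simp] theorem mul_val (x y : WittExtension K) :
    (x * y).val = x.val + y.val + wittCocycleFun K x.base y.base := rfl
@[simp] theorem one_base : (1 : WittExtension K).base = 1 := rfl
@[simp] theorem one_val : (1 : WittExtension K).val = 0 := rfl
@[simp] theorem inv_base (x : WittExtension K) : x⁻¹.base = x.base⁻¹ := rfl
@[simp] theorem inv_val (x : WittExtension K) : x⁻¹.val = -x.val := rfl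

instance : Group (WittExtension K) :=
  Group.ofLeftAxioms
    (fun x y z => by
      ext1
      · simp [mul_assoc]
      · have := wittCocycleFun_cocycle x.base y.base z.base
        simp only [mul_val, mul_base]
        linear_combination this)
    (fun x => by ext1 <;> simp [wittCocycleFun_one_left])
    (fun x => by ext1 <;> simp [wittCocycleFun_of_mul_eq_one])

/-- Commutators only depend on the images in `PSL(2, K)`. -/
theorem commutator_eq (x y : WittExtension K) :
    x * y * x⁻¹ * y⁻¹ = (⟨x.base, 0⟩ * ⟨y.base, 0⟩ * ⟨x.base⁻¹, 0⟩ * ⟨y.base⁻¹, 0⟩) := by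
  ext1
  · simp
  · simp only [mul_val, mul_base, inv_base, inv_val]
    ring

/-- `x` is a product of `n` commutators. -/
def IsCommProd (n : ℕ) (x : WittExtension K) : Prop :=
  ∃ l : List (WittExtension K × WittExtension K), l.length = n ∧
    (l.map fun p => p.1 * p.2 * p.1⁻¹ * p.2⁻¹).prod = x

theorem IsCommProd.mul {m n : ℕ} {x y : WittExtension K} (hx : IsCommProd m x)
    (hy : IsCommProd n y) : IsCommProd (m + n) (x * y) := by
  obtain ⟨l, rfl, rfl⟩ := hx
  obtain ⟨l', rfl, rfl⟩ := hy
  exact ⟨l ++ l', by simp, by simp⟩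

theorem isCommProd_commutator (x y : WittExtension K) : IsCommProd 1 (x * y * x⁻¹ * y⁻¹) :=
  ⟨[(x, y)], rfl, by simp⟩

theorem IsCommProd.conj {n : ℕ} {x : WittExtension K} (hx : IsCommProd n x)
    (z : WittExtension K) : IsCommProd n (z * x * z⁻¹) := by
  obtain ⟨l, rfl, rfl⟩ := hx
  refine ⟨l.map fun p => (z * p.1 * z⁻¹, z * p.2 * z⁻¹), by simp, ?_⟩
  induction l with
  | nil => simp
  | cons p l ih =>
    simp only [List.map_cons, List.prod_cons, ih]
    group

/-- The element of the extension given by a matrix and an element of the Witt ring. -/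
def lift (A : SL(2, K)) (t : WittRing K) : WittExtension K := ⟨(A : PSL(2, K)), t⟩

theorem lift_mul (A B : SL(2, K)) (s t : WittRing K) :
    lift A s * lift B t =
      lift (A * B) (s + t + bracket (-(A.1 1 0 * (A * B).1 1 0 * B.1 1 0))) := rfl

theorem lift_mul_of_left {A : SL(2, K)} (h : A.1 1 0 = 0) (B : SL(2, K)) (s t : WittRing K) :
    lift A s * lift B t = lift (A * B) (s + t) := by
  rw [lift_mul, h]; simp

theorem lift_mul_of_right (A : SL(2, K)) {B : SL(2, K)} (h : B.1 1 0 = 0) (s t : WittRing K) :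
    lift A s * lift B t = lift (A * B) (s + t) := by
  rw [lift_mul, h]; simp

/-- `-1` is central, so it dies in `PSL(2, K)`; hence boundary monodromies matter only up to sign.
-/
theorem lift_neg (A : SL(2, K)) (t : WittRing K) : lift (-A) t = lift A t := by
  ext1
  · refine QuotientGroup.eq.mpr ?_
    rw [Matrix.SpecialLinearGroup.mem_center_iff]
    refine ⟨-1, by simp, ?_⟩
    have : (-A)⁻¹ * A = -1 := by
      rw [inv_mul_eq_iff_eq_mul]; simp
    rw [this]
    ext i j
    fin_cases i <;> fin_cases j <;> simp
  · rfl

/-- Stating conjugacy as `z * x = y * z` avoids inverses: when `x` and `y` are upper triangular, no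
cocycle term appears. -/
theorem IsCommProd.of_mul_eq {n : ℕ} {x y z : WittExtension K} (hx : IsCommProd n x)
    (h : z * x = y * z) : IsCommProd n y := by
  have := hx.conj z
  rwa [h, mul_inv_cancel_right] at this

/-- The matrix with the given entries as an element of `SL(2, K)`. -/
def sl (a b c d : K) (h : a * d - b * c = 1) : SL(2, K) :=
  ⟨!![a, b; c, d], by rw [Matrix.det_fin_two_of, h]⟩

theorem sl_apply_one_zero (a b c d : K) (h) : (sl a b c d h).1 1 0 = c := rfl

theorem sl_congr {a b c d a' b' c' d' : K} {h h'} (h1 : a = a') (h2 : b = b') (h3 : c = c')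
    (h4 : d = d') : sl a b c d h = sl a' b' c' d' h' := by
  subst h1 h2 h3 h4; rfl

theorem sl_mul (a b c d a' b' c' d' : K) (h h') :
    sl a b c d h * sl a' b' c' d' h' =
      sl (a * a' + b * c') (a * b' + b * d') (c * a' + d * c') (c * b' + d * d')
        (by linear_combination (a' * d' - b' * c') * h + h') :=
  Subtype.ext (by rw [Matrix.SpecialLinearGroup.coe_mul]; simp [sl])

theorem sl_inv (a b c d : K) (h) :
    (sl a b c d h)⁻¹ = sl d (-b) (-c) a (by linear_combination h) :=
  Subtype.ext (by rw [Matrix.SpecialLinearGroup.coe_inv]; simp [sl, Matrix.adjugate_fin_two])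

theorem sl_neg (a b c d : K) (h) :
    -sl a b c d h = sl (-a) (-b) (-c) (-d) (by linear_combination h) :=
  Subtype.ext (by rw [Matrix.SpecialLinearGroup.coe_neg]; simp [sl])

/-- The upper triangular matrix with diagonal `l, l⁻¹`. -/
def upper (l : Kˣ) (m : K) : SL(2, K) := sl l m 0 (l : K)⁻¹ (by simp)

@[simp] theorem upper_apply_one_zero (l : Kˣ) (m : K) : (upper l m).1 1 0 = 0 := rfl

theorem upper_mul (l l' : Kˣ) (m m' : K) :
    upper l m * upper l' m' = upper (l * l') (l * m' + m * (l' : K)⁻¹) := by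
  rw [upper, upper, sl_mul]
  apply sl_congr <;> simp [mul_comm]

theorem upper_neg (l : Kˣ) (m : K) : upper (-l) m = -upper l (-m) := by
  rw [upper, upper, sl_neg]
  apply sl_congr <;> simp

theorem upper_one : upper (1 : Kˣ) (0 : K) = 1 :=
  Subtype.ext (by simp [upper, sl, Matrix.one_fin_two])

/-- Off-diagonal entries of hyperbolic elements can be changed by conjugation. -/
theorem IsCommProd.upper {n : ℕ} {l : Kˣ} (hl : l ^ 2 ≠ 1) {m : K} {t : WittRing K}
    (h : IsCommProd n (lift (upper l m) t)) (m' : K) : IsCommProd n (lift (upper l m') t) := by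
  have hl0 : (l : K) ≠ 0 := l.ne_zero
  have hl' : 1 - (l : K) ^ 2 ≠ 0 := by
    intro h0
    apply hl
    ext
    push_cast
    linear_combination -h0
  -- Conjugating by a unipotent with entry `c` changes `m` by `c (l⁻¹ - l)` after rescaling; the
  -- equation `m + c l⁻¹ = l c + m'` determines `c` since `l² ≠ 1`.
  refine h.of_mul_eq (z := lift (WittExtension.upper 1 ((m' - m) * l / (1 - (l : K) ^ 2))) 0) ?_
  rw [lift_mul_of_left (by simp), lift_mul_of_left (by simp), upper_mul, upper_mul, zero_add,
    add_zero, one_mul, mul_one]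
  congr 2
  simp only [Units.val_one, inv_one, mul_one, one_mul]
  field_simp
  ring

/-- The rotation exchanging the coordinate lines. -/
def rot (K : Type u) [Field K] : SL(2, K) := sl 0 1 (-1) 0 (by simp)

/-- The rotation swaps the two diagonal entries at no cocycle cost, so the monodromy is inverted
while the Witt coordinate is not negated. This allows two surfaces with equal boundary monodromy to
be glued. -/
theorem IsCommProd.inv_upper {n : ℕ} {l : Kˣ} {t : WittRing K}
    (h : IsCommProd n (lift (WittExtension.upper l 0) t)) :
    IsCommProd n (lift (WittExtension.upper l⁻¹ 0) t) := by
  refine h.of_mul_eq (z := lift (rot K) 0) ?_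
  rw [lift_mul_of_right _ (by simp), lift_mul_of_left (by simp), zero_add, add_zero]
  congr 1
  rw [WittExtension.upper, WittExtension.upper, rot, sl_mul, sl_mul]
  apply sl_congr <;> simp

theorem IsCommProd.neg_upper {n : ℕ} {l : Kˣ} (hl : l ^ 2 ≠ 1) {m : K} {t : WittRing K}
    (h : IsCommProd n (lift (WittExtension.upper (-l) m) t)) :
    IsCommProd n (lift (WittExtension.upper l 0) t) := by
  rw [upper_neg, lift_neg] at h
  exact h.upper hl 0

/-! ### Building surfaces from one-holed tori and pairs of pants -/

/-- The one-holed torus: commutators with prescribed boundary monodromy. -/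
theorem isCommProd_torus (a b s : Kˣ) (h : (a * b * s ^ 2) ^ 2 ≠ 1) :
    IsCommProd 1 (lift (upper (a * b * s ^ 2) 0) (unitClass a + unitClass b)) := by
  have ha : (a : K) ≠ 0 := a.ne_zero
  have hb : (b : K) ≠ 0 := b.ne_zero
  have hs : (s : K) ≠ 0 := s.ne_zero
  -- Chosen so that `A⁻¹B⁻¹AB` is upper triangular with diagonal entry `-a b s²`, while the cocycle
  -- takes the values `[a]` on `(A, B)` and `-[b]` on `(B, A)`.
  let A : SL(2, K) := sl 0 (s * a) (-(s * a : K)⁻¹) (s + (s * a : K)⁻¹ * (a + b))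
    (by field_simp; ring)
  let B : SL(2, K) := sl (a + b) ((b : K)⁻¹ * a) 1 (b : K)⁻¹ (by field_simp; ring)
  obtain ⟨m, hm⟩ : ∃ m, A * B = B * A * upper (-(a * b * s ^ 2)) m := by
    refine ⟨(A⁻¹ * B⁻¹ * A * B).1 0 1, ?_⟩
    have : A⁻¹ * B⁻¹ * A * B = upper (-(a * b * s ^ 2)) ((A⁻¹ * B⁻¹ * A * B).1 0 1) := by
      simp only [A, B, upper, sl_inv, sl_mul]
      apply sl_congr
      · push_cast; field_simp; ring
      · rfl
      · field_simp; ring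
      · push_cast; field_simp; ring
    rw [← this]
    group
  have hmul : lift A 0 * lift B 0 = lift B 0 * lift A 0 *
      lift (upper (-(a * b * s ^ 2)) m) (unitClass a + unitClass b) := by
    rw [lift_mul, lift_mul, lift_mul_of_right _ (by simp), ← hm]
    congr 1
    simp only [A, B, sl_mul, sl_apply_one_zero, zero_add]
    have e1 := bracket_mul_sq (a : K) (inv_ne_zero ha)
    have e2 := bracket_mul_sq (b : K) (inv_ne_zero (mul_ne_zero (mul_ne_zero hs ha) hb))
    have e3 := bracket_add_neg ((b : K) * ((s * a * b : K)⁻¹) ^ 2)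
    rw [e2] at e3
    rw [← bracket_val, ← bracket_val, ← e1, eq_neg_of_add_eq_zero_left e3]
    have e4 : (-(-(s * a : K)⁻¹ * (-(s * a : K)⁻¹ * (a + b) + (s + (s * a : K)⁻¹ * (a + b)) * 1) *
        1) : K) = a * (a : K)⁻¹ ^ 2 := by
      field_simp
      ring
    have e5 : (-(1 * (1 * 0 + (b : K)⁻¹ * -(s * a : K)⁻¹) * -(s * a : K)⁻¹) : K) =
        -(b * (s * a * b : K)⁻¹ ^ 2) := by
      field_simp
      ring
    rw [e4, e5]
    abel
  -- The commutator of the inverses is `(BA)⁻¹(AB)`, whose Witt coordinate is the difference `[a] -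
  -- (-[b])`.
  have := isCommProd_commutator (lift A 0)⁻¹ (lift B 0)⁻¹
  rw [inv_inv, inv_inv, mul_assoc, hmul, ← mul_inv_rev, inv_mul_cancel_left] at this
  exact this.neg_upper h

/-- The pair of pants: products of two elements with prescribed monodromy of the product. -/
theorem IsCommProd.pants {n n' : ℕ} {l l' : Kˣ} {t t' : WittRing K}
    (hx : IsCommProd n (lift (WittExtension.upper l 0) t)) (hl : l ^ 2 ≠ 1)
    (hx' : IsCommProd n' (lift (WittExtension.upper l' 0) t')) (hl' : l' ^ 2 ≠ 1)
    (a b s : Kˣ) (h : (a * b * (l * l') * s ^ 2) ^ 2 ≠ 1) :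
    IsCommProd (n + n') (lift (WittExtension.upper (a * b * (l * l') * s ^ 2) 0)
      (t + t' + (unitClass a + unitClass b))) := by
  set k : Kˣ := -(a * b * (l * l') * s ^ 2) with hk
  have ha : (a : K) ≠ 0 := a.ne_zero
  have hb : (b : K) ≠ 0 := b.ne_zero
  have hs : (s : K) ≠ 0 := s.ne_zero
  have hl0 : (l : K) ≠ 0 := l.ne_zero
  have hl0' : (l' : K) ≠ 0 := l'.ne_zero
  have hk0 : (k : K) ≠ 0 := k.ne_zero
  have hkK : (k : K) = -(a * b * (l * l') * s ^ 2) := by simp [hk]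
  -- The off-diagonal entries are free because both boundaries are hyperbolic. This `m'` makes the
  -- cocycle in the product of the two boundary elements equal to `[a / l²] = [a]`.
  set m' : K := -a / l' with hm'
  have hm0 : m' ≠ 0 := by simp [hm', ha, hl0']
  -- Gives the product of the upper triangular and the rotated factor the trace `k + k⁻¹`.
  set m : K := (l / l' + l' / l - k - (k : K)⁻¹) / m' with hm
  -- Makes `(u, 1)` an eigenvector of that product with eigenvalue `k`.
  set u : K := -(k - l' / l) * l / m' with hu
  have h1 := (hx.upper hl m).mul ((hx'.upper hl' m').conj (lift (rot K) 0))
  have e1 : lift (WittExtension.upper l m) t *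
      (lift (rot K) 0 * lift (WittExtension.upper l' m') t' * (lift (rot K) 0)⁻¹) =
      lift (sl (l / l' - m * m') (m * l') (-m' / l) (l' / l)
        (by field_simp; ring)) (t + t' + unitClass a) := by
    have : (lift (rot K) 0)⁻¹ = lift (rot K)⁻¹ 0 := by ext1 <;> simp [lift]
    rw [this, lift_mul_of_right _ (by simp), ← mul_assoc, lift_mul_of_left (by simp), lift_mul]
    simp only [WittExtension.upper, rot, sl_inv, sl_mul, sl_apply_one_zero]
    congr 1
    · apply sl_congr <;> field_simp <;> ring
    · rw [← bracket_val, ← bracket_mul_sq (a : K) (inv_ne_zero hl0), zero_add, add_zero]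
      congr 2
      rw [hm']
      field_simp
      ring
  rw [e1] at h1
  refine IsCommProd.neg_upper h (m := m' / l) ?_
  rw [← hk]
  -- Diagonal entry `k` is reached by conjugating with a matrix whose first column is the
  -- eigenvector. The cocycle enters on one side only, with value `[k m' / l] = [b (a s)²] = [b]`.
  have e2 : lift (WittExtension.upper k (m' / l)) (t + t' + (unitClass a + unitClass b)) =
      (lift (sl u (-1) 1 0 (by ring)) 0)⁻¹ * lift (sl (l / l' - m * m') (m * l') (-m' / l) (l' / l)
        (by field_simp; ring)) (t + t' + unitClass a) * lift (sl u (-1) 1 0 (by ring)) 0 := by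
    rw [mul_assoc, eq_inv_mul_iff_mul_eq, lift_mul_of_right _ (by simp), lift_mul]
    simp only [WittExtension.upper, sl_mul, sl_apply_one_zero]
    congr 1
    · apply sl_congr
      · rw [hm, hu]; field_simp; ring
      · rw [hm, hu]; field_simp; ring
      · rw [hu]; field_simp; ring
      · field_simp; ring
    · rw [zero_add, add_zero, ← add_assoc, ← bracket_val b, ← bracket_mul_sq (b : K) (y := a * s)]
      · congr 2
        rw [hu, hm', hkK]
        field_simp
        ring
      · exact mul_ne_zero ha hs
  rw [e2]
  simpa using h1.conj (lift (sl u (-1) 1 0 (by ring)) 0)⁻¹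


/-- The bad `s` are roots of `X⁴ - c⁻²`, and an infinite field has other nonzero elements. -/
theorem exists_unit_mul_sq_sq_ne_one [Infinite K] (c : Kˣ) :
    ∃ s : Kˣ, (c * s ^ 2) ^ 2 ≠ 1 := by
  classical
  let p : Polynomial K := Polynomial.X ^ 4 - Polynomial.C ((c : K)⁻¹ ^ 2)
  have hp : p ≠ 0 := (Polynomial.monic_X_pow_sub_C _ (by norm_num)).ne_zero
  obtain ⟨x, hx⟩ := Infinite.exists_notMem_finset (insert 0 p.roots.toFinset)
  simp only [Finset.mem_insert, Multiset.mem_toFinset, Polynomial.mem_roots hp, not_or] at hx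
  refine ⟨Units.mk0 x hx.1, fun h => hx.2 ?_⟩
  have hc : (c : K) ≠ 0 := c.ne_zero
  have h' := congrArg (Units.val : Kˣ → K) h
  simp only [Units.val_pow_eq_pow_val, Units.val_mul, Units.val_mk0, Units.val_one] at h'
  simp only [Polynomial.IsRoot, p, Polynomial.eval_sub, Polynomial.eval_pow, Polynomial.eval_X,
    Polynomial.eval_C]
  field_simp
  linear_combination h'

/-- Surfaces of genus `n + 1` with one boundary component and prescribed boundary monodromy. -/
theorem isCommProd_boundary [Infinite K] (n : ℕ) (l : List Kˣ) (hl : l.length = 4 * n + 2) (s : Kˣ)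
    (h : (l.prod * s ^ 2) ^ 2 ≠ 1) :
    IsCommProd (n + 1) (lift (upper (l.prod * s ^ 2) 0) (l.map unitClass).sum) := by
  induction n generalizing l s with
  | zero =>
    match l, hl with
    | [a, b], _ =>
      simp only [List.prod_cons, List.prod_nil, mul_one, List.map_cons, List.sum_cons,
        List.map_nil, List.sum_nil, add_zero] at h ⊢
      exact isCommProd_torus a b s h
  | succ n ih =>
    match l, hl with
    | a :: b :: c :: d :: l, hl =>
      obtain ⟨s₁, h₁⟩ := exists_unit_mul_sq_sq_ne_one (c * d)
      obtain ⟨s₂, h₂⟩ := exists_unit_mul_sq_sq_ne_one l.prod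
      -- Each extra handle uses four units: `c, d` for a new torus and `a, b` for the pants
      -- attaching it. The auxiliary squares chosen for hyperbolicity are absorbed into `s`.
      have hs : (a :: b :: c :: d :: l).prod * s ^ 2 =
          a * b * ((l.prod * s₂ ^ 2) * (c * d * s₁ ^ 2)) * (s * (s₁ * s₂)⁻¹) ^ 2 := by
        ext
        simp
        field_simp
      rw [hs] at h ⊢
      have := (ih l (by simp at hl; omega) s₂ h₂).pants h₂ (isCommProd_torus c d s₁ h₁) h₁ a b _ h
      convert this using 2
      simp only [List.map_cons, List.sum_cons]
      abel

/-- The central elements that are products of `g` commutators. -/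
theorem isCommProd_central [Infinite K] (n : ℕ) (l : List Kˣ) (hl : l.length = 4 * n) (r : Kˣ)
    (hr : l.prod = r ^ 2 ∨ l.prod = -r ^ 2) : IsCommProd (n + 1) (lift 1 (l.map unitClass).sum) := by
  match n, l, hl with
  | 0, [], _ => exact ⟨[(1, 1)], rfl, by ext1 <;> simp [lift]⟩
  | n + 1, a :: b :: l, hl =>
    obtain ⟨s, h⟩ := exists_unit_mul_sq_sq_ne_one (a * b)
    -- Since the total product is `±r²`, the remaining units have the same product as `a, b` up to
    -- sign and squares, so both boundaries can be given the same monodromy in `PSL(2, K)`.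
    have e : l.prod * ((a * b) * (s * r⁻¹)) ^ 2 = a * b * s ^ 2 ∨
        l.prod * ((a * b) * (s * r⁻¹)) ^ 2 = -(a * b * s ^ 2) := by
      simp only [List.prod_cons] at hr
      have : l.prod * ((a * b) * (s * r⁻¹)) ^ 2 = (a * (b * l.prod)) * (r ^ 2)⁻¹ * (a * b * s ^ 2) := by
        ext; simp; field_simp
      rw [this]
      rcases hr with hr | hr <;> simp [hr]
    have h' : (l.prod * ((a * b) * (s * r⁻¹)) ^ 2) ^ 2 ≠ 1 := by
      rcases e with e | e <;> simpa [e] using h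
    have h2 := isCommProd_boundary n l (by simp at hl; omega) _ h'
    have h3 : IsCommProd (n + 1) (lift (upper (a * b * s ^ 2) 0) (l.map unitClass).sum) := by
      rcases e with e | e
      · rwa [e] at h2
      · rw [e] at h2
        exact h2.neg_upper h
    -- Closing the surface: the inverse diagonal matrices multiply to 1 without a cocycle term.
    have h4 := h3.inv_upper.mul (isCommProd_torus a b s h)
    rw [lift_mul_of_left (by simp), upper_mul, inv_mul_cancel] at h4
    simp only [mul_zero, zero_mul, add_zero, upper_one] at h4
    convert h4 using 2
    simp only [List.map_cons, List.sum_cons]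
    abel

end WittExtension
end CentralExtension
end

noncomputable section

/-! ### Witt classes as products of commutators -/

section FundamentalCycle

variable {K : Type u} [Field K]

theorem barFan_append_singleton {G : Type u} [Group G] (p : G) (l : List G) (s : G) :
    barFan p (l ++ [s]) = barFan p l + Finsupp.single (p * l.prod, s) 1 := by
  induction l generalizing p with
  | nil => simp [barFan]
  | cons t l ih => simp [barFan, ih, mul_assoc, add_assoc]

theorem chainPairing_zero {G : Type u} (R : Type u) [CommRing R] (f : G × G → R) :
    chainPairing R 0 f = 0 := by
  simp [chainPairing_apply]

theorem chainPairing_add {G : Type u} (R : Type u) [CommRing R] (z z' : G × G →₀ ℤ)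
    (f : G × G → R) : chainPairing R (z + z') f = chainPairing R z f + chainPairing R z' f := by
  simp only [chainPairing_apply]
  exact Finsupp.sum_add_index' (by simp) (by intros; exact add_smul _ _ _)

theorem chainPairing_sub {G : Type u} (R : Type u) [CommRing R] (z z' : G × G →₀ ℤ)
    (f : G × G → R) : chainPairing R (z - z') f = chainPairing R z f - chainPairing R z' f := by
  rw [eq_sub_iff_add_eq, ← chainPairing_add, sub_add_cancel]

theorem chainPairing_single {G : Type u} (R : Type u) [CommRing R] (p : G × G) (n : ℤ)
    (f : G × G → R) : chainPairing R (Finsupp.single p n) f = n • f p := by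
  simp [chainPairing_apply]

theorem chainPairing_sum {G : Type u} {ι : Type*} (R : Type u) [CommRing R] (s : Finset ι)
    (z : ι → G × G →₀ ℤ) (f : G × G → R) :
    chainPairing R (∑ i ∈ s, z i) f = ∑ i ∈ s, chainPairing R (z i) f := by
  classical
  induction s using Finset.induction_on with
  | empty => simp [chainPairing_zero]
  | insert i s hi ih => simp [Finset.sum_insert hi, chainPairing_add, ih]

/-- The Witt cocycle of the triangles of the surface. -/
def pulledCocycle {G : Type u} [Group G] (ρ : G →* PSL(2, K)) (p : G × G) : WittRing K :=
  wittCocycleFun K (ρ p.1) (ρ p.2)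

theorem pulledCocycle_of_mul_eq_one {G : Type u} [Group G] (ρ : G →* PSL(2, K)) {p q : G}
    (h : p * q = 1) : pulledCocycle ρ (p, q) = 0 :=
  wittCocycleFun_of_mul_eq_one (by rw [← map_mul, h, map_one])

theorem bundleWittClass_eq_chainPairing {g : ℕ} (ρ : SurfaceGroup.{u} g →* PSL(2, K)) :
    bundleWittClass ρ = chainPairing (WittRing K) (fundamentalCycle g) (pulledCocycle ρ) := by
  rw [bundleWittClass_eq, chainPairing_apply]; rfl

/-- The correction terms of the fundamental cycle are pairs `(x, x⁻¹)`, on which the normalised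
cocycle vanishes. -/
theorem bundleWittClass_eq_barFan {g : ℕ} (ρ : SurfaceGroup.{u} g →* PSL(2, K)) :
    bundleWittClass ρ =
      chainPairing (WittRing K) (barFan 1 (surfaceWord g)) (pulledCocycle ρ) := by
  rw [bundleWittClass_eq_chainPairing, fundamentalCycle, chainPairing_sub, chainPairing_sub,
    chainPairing_sum, chainPairing_single]
  simp [chainPairing_add, chainPairing_single, pulledCocycle_of_mul_eq_one]

/-- The fan of a word computes the product of the standard lifts of its letters. -/
theorem lift_mul_prod {G : Type u} [Group G] (ρ : G →* PSL(2, K)) (p : G) (t : WittRing K)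
    (l : List G) :
    (⟨ρ p, t⟩ * (l.map fun s => (⟨ρ s, 0⟩ : WittExtension K)).prod : WittExtension K) =
      ⟨ρ (p * l.prod), t + chainPairing (WittRing K) (barFan p l) (pulledCocycle ρ)⟩ := by
  induction l generalizing p t with
  | nil => simp [barFan, chainPairing_zero]
  | cons s l ih =>
    have : (⟨ρ p, t⟩ * ⟨ρ s, 0⟩ : WittExtension K) =
        ⟨ρ (p * s), t + pulledCocycle ρ (p, s)⟩ := by
      ext1 <;> simp [pulledCocycle]
    rw [List.map_cons, List.prod_cons, ← mul_assoc, this, ih, List.prod_cons, ← mul_assoc, barFan,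
      chainPairing_add, chainPairing_single, one_smul, add_assoc]

/-- The boundary word of the polygon is trivial in the group, so the product of its standard lifts
is central; the terms accumulated along the fan are its Witt coordinate. -/
theorem prod_lift_surfaceWord {g : ℕ} (ρ : SurfaceGroup.{u} g →* PSL(2, K)) :
    (List.ofFn fun i : Fin g => ((⟨ρ (surfaceA g i), 0⟩ * ⟨ρ (surfaceB g i), 0⟩ *
      ⟨(ρ (surfaceA g i))⁻¹, 0⟩ * ⟨(ρ (surfaceB g i))⁻¹, 0⟩ : WittExtension K))).prod =
      ⟨1, bundleWittClass ρ⟩ := by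
  have h := lift_mul_prod ρ 1 0 (surfaceWord g)
  rw [surfaceWord_prod, zero_add, ← bundleWittClass_eq_barFan, mul_one, map_one] at h
  have h1 : (⟨1, 0⟩ : WittExtension K) = 1 := rfl
  rw [h1, one_mul] at h
  rw [← h, surfaceWord, List.map_flatten, List.prod_flatten, List.map_map, List.map_ofFn]
  congr 2
  funext i
  simp [mul_assoc]

/-- Products of `g` commutators in the central extension come from representations of the surface
group of genus `g`. -/
theorem WittExtension.IsCommProd.exists_bundleWittClass_eq {g : ℕ} {q : WittRing K}
    (h : WittExtension.IsCommProd g (⟨1, q⟩ : WittExtension K)) :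
    ∃ ρ : SurfaceGroup.{u} g →* PSL(2, K), bundleWittClass ρ = q := by
  obtain ⟨l, rfl, hl⟩ := h
  let f : SurfaceGenerator.{u} l.length → PSL(2, K)
    | .a i => (l.get i).1.base
    | .b i => (l.get i).2.base
  have hl' : (List.ofFn fun i : Fin l.length => ((l.get i).1 * (l.get i).2 * (l.get i).1⁻¹ *
      (l.get i).2⁻¹ : WittExtension K)).prod = ⟨1, q⟩ := by
    rw [← hl]
    conv_rhs => rw [← List.ofFn_get l, List.map_ofFn]
    rfl
  have hbase : ∀ L : List (WittExtension K), L.prod.base = (L.map WittExtension.base).prod := by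
    intro L
    induction L with
    | nil => rfl
    | cons x L ih => simp [ih]
  have hf : ∀ r ∈ ({surfaceRelator.{u} l.length} : Set _), FreeGroup.lift f r = 1 := by
    rintro _ rfl
    have := congrArg WittExtension.base hl'
    rw [hbase, List.map_ofFn] at this
    rw [surfaceRelator, map_list_prod, List.map_ofFn]
    refine Eq.trans ?_ this
    congr 2
    funext i
    simp [f]
  refine ⟨PresentedGroup.toGroup hf, ?_⟩
  have h := prod_lift_surfaceWord (PresentedGroup.toGroup hf)
  have hA : ∀ i, PresentedGroup.toGroup hf (surfaceA _ i) = (l.get i).1.base :=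
    fun i => PresentedGroup.toGroup.of hf
  have hB : ∀ i, PresentedGroup.toGroup hf (surfaceB _ i) = (l.get i).2.base :=
    fun i => PresentedGroup.toGroup.of hf
  simp only [hA, hB] at h
  -- The given factors may have nonzero Witt coordinates; commutators do not see them.
  simp only [WittExtension.commutator_eq] at hl'
  exact congrArg WittExtension.val (h.symm.trans hl')

end FundamentalCycle

/-! ### The norm bound -/

section Norm

variable {K : Type u} [Field K]

theorem isWordOfLength_bracket (x : K) : ∃ m ≤ 1, IsWordOfLength (bracket x) m := by
  by_cases hx : x = 0
  · exact ⟨0, by simp, Fin.elim0, Fin.elim0, by simp [hx]⟩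
  · exact ⟨1, le_rfl, fun _ => 1, fun _ => Units.mk0 x hx, by simp [bracket_of_ne hx]⟩

theorem isWordOfLength_wittNorm (x : WittRing K) : IsWordOfLength x (wittNorm x) :=
  Nat.sInf_mem (exists_isWordOfLength x)

theorem wittNorm_add_le (x y : WittRing K) : wittNorm (x + y) ≤ wittNorm x + wittNorm y :=
  Nat.sInf_le ((isWordOfLength_wittNorm x).add (isWordOfLength_wittNorm y))

theorem wittNorm_zero : wittNorm (0 : WittRing K) = 0 :=
  Nat.le_zero.mp (Nat.sInf_le ⟨Fin.elim0, Fin.elim0, by simp⟩)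

theorem wittNorm_bracket_le (x : K) : wittNorm (bracket x) ≤ 1 := by
  obtain ⟨m, hm, h⟩ := isWordOfLength_bracket x
  exact (Nat.sInf_le h).trans hm

theorem wittNorm_wittCocycleFun_le (p q : PSL(2, K)) : wittNorm (wittCocycleFun K p q) ≤ 1 := by
  induction p using QuotientGroup.induction_on with | _ A
  induction q using QuotientGroup.induction_on with | _ B
  rw [wittCocycleFun_mk]
  exact wittNorm_bracket_le _

theorem wittNorm_barFan_le {G : Type u} [Group G] (ρ : G →* PSL(2, K)) (p : G) (l : List G) :
    wittNorm (chainPairing (WittRing K) (barFan p l) (pulledCocycle ρ)) ≤ l.length := by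
  induction l generalizing p with
  | nil => simp [barFan, chainPairing_zero, wittNorm_zero]
  | cons s l ih =>
    rw [barFan, chainPairing_add, chainPairing_single, one_smul, List.length_cons, add_comm]
    exact (wittNorm_add_le _ _).trans (add_le_add (ih _) (wittNorm_wittCocycleFun_le _ _))

theorem length_surfaceWord (g : ℕ) : (surfaceWord.{u} g).length = 4 * g := by
  simp [surfaceWord, List.length_flatten, List.map_ofFn, Function.comp_def, mul_comm]

/-- The upper bound on the norm of Witt classes of flat bundles. -/
theorem wittNorm_bundleWittClass_le {g : ℕ} (hg : 1 ≤ g) (ρ : SurfaceGroup.{u} g →* PSL(2, K)) :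
    wittNorm (bundleWittClass ρ) ≤ 4 * g - 2 := by
  have hlen := length_surfaceWord.{u} g
  have hprod := surfaceWord_prod.{u} g
  rw [bundleWittClass_eq_barFan]
  generalize surfaceWord.{u} g = l at *
  obtain ⟨s, l, rfl⟩ := List.exists_cons_of_length_pos (l := l) (by omega)
  obtain rfl | ⟨l, t, rfl⟩ := l.eq_nil_or_concat
  · simp at hlen; omega
  -- The first and last fan triangles are `(1, s)` and `(t⁻¹, t)`, both of value zero; this is the
  -- gain from `4g` to `4g - 2`.
  have hst : s * l.prod * t = 1 := by simpa [mul_assoc] using hprod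
  rw [List.concat_eq_append] at hlen ⊢
  rw [← List.cons_append, barFan_append_singleton, barFan, chainPairing_add, chainPairing_add,
    chainPairing_single, chainPairing_single, one_mul, List.prod_cons, one_mul,
    pulledCocycle_of_mul_eq_one ρ hst]
  have : pulledCocycle ρ (1, s) = 0 := by
    simp [pulledCocycle, wittCocycleFun_one_left]
  rw [this, smul_zero, zero_add, add_zero]
  refine (wittNorm_barFan_le ρ _ _).trans ?_
  simp at hlen
  omega

end Norm

end

noncomputable section

/-! ### The Witt class modulo `I²₊(K)` -/

section FundamentalIdeal

variable {K : Type u} [Field K]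

theorem unitClass_mul (a b : Kˣ) : unitClass (a * b) = unitClass a * unitClass b := by
  simp only [unitClass, map_mul]

theorem unitClass_one : unitClass (1 : Kˣ) = 1 := by
  simp only [unitClass, map_one]

theorem unitClass_neg (a : Kˣ) : unitClass (-a) = -unitClass a := by
  have h := bracket_add_neg (a : K)
  rw [← Units.val_neg, bracket_val, bracket_val] at h
  exact (neg_eq_of_add_eq_zero_right h).symm

theorem dimModTwo_unitClass (a : Kˣ) : dimModTwo K (unitClass a) = 1 := by
  change (MonoidAlgebra.lift ℤ (ZMod 2) Kˣ 1) (MonoidAlgebra.of ℤ Kˣ a) = 1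
  simp

theorem unitClass_sub_one_mem (a : Kˣ) : unitClass a - 1 ∈ fundamentalIdeal K := by
  rw [fundamentalIdeal, RingHom.mem_ker, map_sub, dimModTwo_unitClass, map_one, sub_self]

theorem one_add_one_mem_fundamentalIdeal : (1 + 1 : WittRing K) ∈ fundamentalIdeal K := by
  rw [fundamentalIdeal, RingHom.mem_ker, map_add, map_one]
  decide

theorem mul_mem_iSqPlus {x y : WittRing K} (hx : x ∈ fundamentalIdeal K)
    (hy : y ∈ fundamentalIdeal K) : x * y ∈ iSqPlus K :=
  AddSubgroup.subset_closure (Or.inl (by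
    rw [SetLike.mem_coe, pow_two]; exact Ideal.mul_mem_mul hx hy))

theorem one_add_one_mem_iSqPlus : (1 + 1 : WittRing K) ∈ iSqPlus K :=
  AddSubgroup.subset_closure (Or.inr (by rw [unitClass_one]; rfl))

/-- The class of `⟨1, x⟩` modulo `I²₊(K)`. -/
def signedDisc (x : K) : WittRing K ⧸ iSqPlus K :=
  QuotientAddGroup.mk' (iSqPlus K) (1 + bracket x)

theorem mk_one_add_mk_one :
    QuotientAddGroup.mk' (iSqPlus K) 1 + QuotientAddGroup.mk' (iSqPlus K) 1 = 0 := by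
  rw [← map_add]
  exact (QuotientAddGroup.eq_zero_iff _).mpr one_add_one_mem_iSqPlus

theorem mk_bracket (x : K) : QuotientAddGroup.mk' (iSqPlus K) (bracket x) =
    QuotientAddGroup.mk' (iSqPlus K) 1 + signedDisc x := by
  rw [signedDisc, map_add, ← add_assoc, mk_one_add_mk_one, zero_add]

/-- The defect is `1 + [x] + [y] - [xy] = 2 - ([x] - 1)([y] - 1)`. -/
theorem signedDisc_mul {x y : K} (hx : x ≠ 0) (hy : y ≠ 0) :
    signedDisc (x * y) = signedDisc x + signedDisc y := by
  rw [signedDisc, signedDisc, signedDisc, ← map_add]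
  refine QuotientAddGroup.eq.mpr ?_
  rw [bracket_of_ne hx, bracket_of_ne hy, bracket_of_ne (mul_ne_zero hx hy), Units.mk0_mul,
    unitClass_mul]
  convert sub_mem one_add_one_mem_iSqPlus (mul_mem_iSqPlus (unitClass_sub_one_mem (Units.mk0 x hx))
    (unitClass_sub_one_mem (Units.mk0 y hy))) using 1
  ring

/-- For `x ≠ 0` the difference is `2[x] = 2([x] - 1) + 2`, where 2 itself lies in `I(K)`. -/
theorem signedDisc_neg (x : K) : signedDisc (-x) = signedDisc x := by
  rw [signedDisc, signedDisc]
  refine QuotientAddGroup.eq.mpr ?_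
  by_cases hx : x = 0
  · simp [hx]
  rw [eq_neg_of_add_eq_zero_right (bracket_add_neg x), bracket_of_ne hx]
  convert add_mem (mul_mem_iSqPlus one_add_one_mem_fundamentalIdeal
    (unitClass_sub_one_mem (Units.mk0 x hx))) one_add_one_mem_iSqPlus using 1
  ring

theorem signedDisc_one : signedDisc (1 : K) = 0 := by
  have := signedDisc_mul (one_ne_zero (α := K)) one_ne_zero
  rw [mul_one] at this
  exact left_eq_add.mp this

theorem signedDisc_add_self {x : K} (hx : x ≠ 0) : signedDisc x + signedDisc x = 0 := by
  rw [← signedDisc_mul hx hx, signedDisc, ← pow_two, ← one_mul (x ^ 2), bracket_mul_sq _ hx]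
  exact signedDisc_one

open Classical in
/-- A cochain on `SL(2, K)` whose coboundary is the Witt cocycle modulo `I²₊(K)`. -/
def discCochain (A : SL(2, K)) : WittRing K :=
  if A.1 1 0 = 0 then 1 + bracket (A.1 1 1) else bracket (A.1 1 0)

theorem mk_discCochain_of_eq {A : SL(2, K)} (h : A.1 1 0 = 0) :
    QuotientAddGroup.mk' (iSqPlus K) (discCochain A) = signedDisc (A.1 1 1) := by
  rw [discCochain, if_pos h]; rfl

theorem mk_discCochain_of_ne {A : SL(2, K)} (h : A.1 1 0 ≠ 0) :
    QuotientAddGroup.mk' (iSqPlus K) (discCochain A) =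
      QuotientAddGroup.mk' (iSqPlus K) 1 + signedDisc (A.1 1 0) := by
  rw [discCochain, if_neg h, mk_bracket]

/-- If no lower left entry vanishes, the cocycle is `1 + d(A₂₁) + d((AB)₂₁) + d(B₂₁)` with `d` =
`signedDisc`; signs are immaterial because these classes are 2-torsion. When a lower left entry is
zero, the cocycle is zero and the lower right entry, used by `discCochain` instead, makes the
formula persist. -/
theorem mk_wittCocycleFun_mk (A B : SL(2, K)) :
    QuotientAddGroup.mk' (iSqPlus K) (wittCocycleFun K (A : PSL(2, K)) (B : PSL(2, K))) =
      QuotientAddGroup.mk' (iSqPlus K) (discCochain B) -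
        QuotientAddGroup.mk' (iSqPlus K) (discCochain (A * B)) +
        QuotientAddGroup.mk' (iSqPlus K) (discCochain A) := by
  have hA := A.2
  have hB := B.2
  rw [Matrix.det_fin_two] at hA hB
  have hc : (A * B).1 1 0 = A.1 1 0 * B.1 0 0 + A.1 1 1 * B.1 1 0 := by
    rw [Matrix.SpecialLinearGroup.coe_mul, Matrix.mul_apply, Fin.sum_univ_two]
  have hd : (A * B).1 1 1 = A.1 1 0 * B.1 0 1 + A.1 1 1 * B.1 1 1 := by
    rw [Matrix.SpecialLinearGroup.coe_mul, Matrix.mul_apply, Fin.sum_univ_two]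
  have h2 := mk_one_add_mk_one (K := K)
  rw [wittCocycleFun_mk]
  by_cases ha : A.1 1 0 = 0
  · have ha' : A.1 1 1 ≠ 0 := by
      intro h; simp [ha, h] at hA
    rw [ha, zero_mul, zero_add] at hc
    rw [ha, zero_mul, zero_add] at hd
    rw [mk_discCochain_of_eq ha, ha]
    simp only [zero_mul, neg_zero, bracket_zero, map_zero]
    by_cases hb : B.1 1 0 = 0
    · have hb' : B.1 1 1 ≠ 0 := by
        intro h; simp [hb, h] at hB
      rw [mk_discCochain_of_eq hb, mk_discCochain_of_eq (by rw [hc, hb, mul_zero]), hd,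
        signedDisc_mul ha' hb']
      abel
    · rw [mk_discCochain_of_ne hb, mk_discCochain_of_ne (by rw [hc]; exact mul_ne_zero ha' hb), hc,
        signedDisc_mul ha' hb]
      abel
  by_cases hb : B.1 1 0 = 0
  · have hb' : B.1 0 0 ≠ 0 := by
      intro h; simp [hb, h] at hB
    have hb'' : B.1 1 1 ≠ 0 := by
      intro h; simp [hb, h] at hB
    rw [hb, mul_zero, add_zero] at hc
    have h3 := signedDisc_mul hb' hb''
    have h4 := signedDisc_add_self hb'
    rw [show B.1 0 0 * B.1 1 1 = 1 by linear_combination hB + B.1 0 1 * hb, signedDisc_one] at h3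
    rw [mk_discCochain_of_eq hb, mk_discCochain_of_ne ha,
      mk_discCochain_of_ne (by rw [hc]; exact mul_ne_zero ha hb'), hc, hb, signedDisc_mul ha hb',
      mul_zero, neg_zero, bracket_zero, map_zero]
    linear_combination (norm := module) h3 + h4
  by_cases hab : (A * B).1 1 0 = 0
  · have e : A.1 1 0 = -(B.1 1 0 * (A * B).1 1 1) := by
      rw [hd]
      rw [hc] at hab
      linear_combination (-A.1 1 0) * hB + B.1 1 1 * hab
    have hd' : (A * B).1 1 1 ≠ 0 := by
      intro h; apply ha; rw [e, h, mul_zero, neg_zero]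
    rw [mk_discCochain_of_eq hab, mk_discCochain_of_ne ha, mk_discCochain_of_ne hb, hab, e,
      signedDisc_neg, signedDisc_mul hb hd', mul_zero, zero_mul, neg_zero, bracket_zero, map_zero]
    have h3 := signedDisc_add_self hb
    linear_combination (norm := module) -h2 - h3
  · have h3 := signedDisc_add_self hab
    rw [mk_discCochain_of_ne hab, mk_discCochain_of_ne ha, mk_discCochain_of_ne hb, mk_bracket,
      signedDisc_neg, signedDisc_mul (mul_ne_zero ha hab) hb, signedDisc_mul ha hab]
    linear_combination (norm := module) h3

/-- Apply the coboundary formula to `A` and `A⁻¹B = ±1`: the cocycle vanishes and `d(±1) = 0`. So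
the cochain descends to `PSL(2, K)`. -/
theorem mk_discCochain_congr {A B : SL(2, K)} (h : (A : PSL(2, K)) = B) :
    QuotientAddGroup.mk' (iSqPlus K) (discCochain A) =
      QuotientAddGroup.mk' (iSqPlus K) (discCochain B) := by
  have hz := QuotientGroup.eq.mp h
  rw [Matrix.SpecialLinearGroup.mem_center_iff] at hz
  obtain ⟨r, hr, hrz⟩ := hz
  have h10 : (A⁻¹ * B).1 1 0 = 0 := by rw [← hrz]; simp
  have h11 : (A⁻¹ * B).1 1 1 = r := by rw [← hrz]; simp
  have h1 := mk_wittCocycleFun_mk A (A⁻¹ * B)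
  have hr' : r = 1 ∨ r = -1 := by simpa using hr
  have h0 : signedDisc r = 0 := by
    rcases hr' with rfl | rfl <;> simp [signedDisc_neg, signedDisc_one]
  rw [mk_discCochain_of_eq h10, h11, h0, wittCocycleFun_mk, h10, mul_zero, neg_zero, bracket_zero,
    map_zero, mul_inv_cancel_left, zero_sub] at h1
  exact (neg_add_eq_zero.mp h1.symm).symm

theorem exists_cochain_wittCocycleFun_sub_mem : ∃ h : PSL(2, K) → WittRing K,
    ∀ p q, wittCocycleFun K p q - (h q - h (p * q) + h p) ∈ iSqPlus K := by
  refine ⟨fun p => discCochain p.out, fun p q => ?_⟩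
  rw [← QuotientAddGroup.eq_zero_iff]
  change QuotientAddGroup.mk' (iSqPlus K) _ = 0
  have h := mk_wittCocycleFun_mk p.out q.out
  rw [QuotientGroup.out_eq', QuotientGroup.out_eq'] at h
  rw [mk_discCochain_congr (A := p.out * q.out) (B := (p * q).out)
    (by rw [QuotientGroup.mk_mul]; simp only [QuotientGroup.out_eq'])] at h
  rw [map_sub, h, map_add, map_sub, sub_self]

theorem bundleWittClass_mem_iSqPlus {g : ℕ} (ρ : SurfaceGroup.{u} g →* PSL(2, K)) :
    bundleWittClass ρ ∈ iSqPlus K := by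
  obtain ⟨h, hh⟩ := exists_cochain_wittCocycleFun_sub_mem (K := K)
  have h0 := chainPairing_coboundary (WittRing K) (fundamentalCycle.{u} g) (fun s => h (ρ s))
  rw [barBoundary_fundamentalCycle, Finsupp.sum_zero_index] at h0
  rw [bundleWittClass_eq_chainPairing, ← sub_zero (chainPairing _ _ _), ← h0, ← map_sub,
    chainPairing_apply]
  refine sum_mem fun p _ => zsmul_mem ?_ _
  simpa [pulledCocycle] using hh (ρ p.1) (ρ p.2)

end FundamentalIdeal

/-! ### Dimension and discriminant modulo sign -/

section Discriminant

variable {K : Type u} [Field K]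

/-- The squares up to sign. -/
def signedSquares (K : Type u) [Field K] : Subgroup Kˣ where
  carrier := {x | ∃ r, x = r ^ 2 ∨ x = -r ^ 2}
  one_mem' := ⟨1, by simp⟩
  mul_mem' := by
    rintro _ _ ⟨r, rfl | rfl⟩ ⟨s, rfl | rfl⟩ <;> exact ⟨r * s, by simp [mul_pow]⟩
  inv_mem' := by
    rintro _ ⟨r, rfl | rfl⟩ <;> exact ⟨r⁻¹, by simp [inv_neg]⟩

/-- The group of units modulo squares and signs, written additively. -/
def SignedSquareClass (K : Type u) [Field K] : Type u := Additive (Kˣ ⧸ signedSquares K)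

instance : AddCommGroup (SignedSquareClass K) :=
  inferInstanceAs (AddCommGroup (Additive (Kˣ ⧸ signedSquares K)))

/-- The class of a unit modulo squares and signs. -/
def signedSquareClass (a : Kˣ) : SignedSquareClass K :=
  Additive.ofMul (QuotientGroup.mk a : Kˣ ⧸ signedSquares K)

theorem signedSquareClass_one : signedSquareClass (1 : Kˣ) = 0 := rfl

theorem signedSquareClass_mul (a b : Kˣ) :
    signedSquareClass (a * b) = signedSquareClass a + signedSquareClass b := rfl

theorem signedSquareClass_eq_zero {a : Kˣ} : signedSquareClass a = 0 ↔ a ∈ signedSquares K :=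
  QuotientGroup.eq_one_iff a

theorem signedSquareClass_prod {ι : Type*} (s : Finset ι) (a : ι → Kˣ) :
    signedSquareClass (∏ i ∈ s, a i) = ∑ i ∈ s, signedSquareClass (a i) :=
  map_sum (⟨⟨fun x => signedSquareClass x.toMul, rfl⟩, fun _ _ => rfl⟩ :
    Additive Kˣ →+ SignedSquareClass K) (fun i => Additive.ofMul (a i)) s

theorem signedSquareClass_surjective : Function.Surjective (signedSquareClass (K := K)) :=
  QuotientGroup.mk_surjective

instance : Module (ZMod 2) (SignedSquareClass K) :=
  AddCommGroup.zmodModule (n := 2) (G := SignedSquareClass K) fun x => by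
    obtain ⟨a, rfl⟩ := signedSquareClass_surjective x
    rw [two_nsmul, ← signedSquareClass_mul]
    exact signedSquareClass_eq_zero.mpr ⟨a, Or.inl (pow_two a).symm⟩

/-- The right action is what the ring structure on `TrivSqZeroExt` requires. -/
instance : Module (ZMod 2)ᵐᵒᵖ (SignedSquareClass K) :=
  Module.compHom _ (RingEquiv.toOpposite (ZMod 2)).symm.toRingHom

instance : IsCentralScalar (ZMod 2) (SignedSquareClass K) := ⟨fun _ _ => rfl⟩

theorem toMatrix'_weightedSumSquares [Invertible (2 : K)] {n : ℕ} (a : Fin n → Kˣ) :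
    QuadraticForm.toMatrix' (QuadraticMap.weightedSumSquares K a) =
      Matrix.diagonal fun i => (a i : K) := by
  ext i j
  rw [QuadraticForm.toMatrix', LinearMap.toMatrix₂'_apply, QuadraticMap.associated_apply]
  simp only [QuadraticMap.weightedSumSquares_apply, ← Finset.sum_sub_distrib]
  have h (k : Fin n) : a k • ((Pi.single i 1 + Pi.single j 1 : Fin n → K) k *
      (Pi.single i 1 + Pi.single j 1 : Fin n → K) k) -
      a k • ((Pi.single i 1 : Fin n → K) k * (Pi.single i 1 : Fin n → K) k) -
      a k • ((Pi.single j 1 : Fin n → K) k * (Pi.single j 1 : Fin n → K) k) =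
      2 * ((if i = k then (a i : K) else 0) * (Pi.single j 1 : Fin n → K) k) := by
    by_cases hi : i = k
    · subst hi
      simp only [Units.smul_def, smul_eq_mul, Pi.add_apply, Pi.single_eq_same, if_true]
      ring
    · simp [hi]
  rw [Finset.sum_congr rfl fun k _ => h k, ← Finset.mul_sum, Matrix.diagonal_apply]
  simp [Pi.single_apply, inv_mul_cancel_left₀ (Invertible.ne_zero (2 : K))]

/-- An isometry multiplies the determinant of the Gram matrix by the square of its own determinant;
`2 ≠ 0` lets the diagonal Gram matrix be recovered from the form. -/
theorem exists_prod_eq_of_equivalent (hchar : (2 : K) ≠ 0) {n : ℕ} {a b : Fin n → Kˣ}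
    (h : QuadraticMap.Equivalent (QuadraticMap.weightedSumSquares K a)
      (QuadraticMap.weightedSumSquares K b)) : ∃ r : Kˣ, ∏ i, a i = r ^ 2 * ∏ i, b i := by
  let _ := invertibleOfNonzero hchar
  obtain ⟨e⟩ := h
  have hcomp : (QuadraticMap.weightedSumSquares K b).comp (e.toLinearEquiv : (Fin n → K) →ₗ[K] _) =
      QuadraticMap.weightedSumSquares K a := by
    ext v
    exact e.map_app v
  have hd := QuadraticForm.discr'_comp (Q := QuadraticMap.weightedSumSquares K b)
    (e.toLinearEquiv : (Fin n → K) →ₗ[K] _)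
  rw [hcomp, QuadraticForm.discr', QuadraticForm.discr', toMatrix'_weightedSumSquares,
    toMatrix'_weightedSumSquares, Matrix.det_diagonal, Matrix.det_diagonal] at hd
  have hdet : (LinearMap.toMatrix' (e.toLinearEquiv : (Fin n → K) →ₗ[K] _)).det ≠ 0 := by
    intro h0
    rw [h0, zero_mul, zero_mul, Finset.prod_eq_zero_iff] at hd
    obtain ⟨i, -, hi⟩ := hd
    exact (a i).ne_zero hi
  refine ⟨Units.mk0 _ hdet, ?_⟩
  ext
  simpa [pow_two] using hd

/-- The signed discriminant of a unit in the ring of dimensions and discriminants. -/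
def discUnitHom (K : Type u) [Field K] : Kˣ →* TrivSqZeroExt (ZMod 2) (SignedSquareClass K) where
  toFun a := TrivSqZeroExt.inl 1 + TrivSqZeroExt.inr (signedSquareClass a)
  map_one' := by ext <;> simp [signedSquareClass_one]
  map_mul' a b := by ext <;> simp [signedSquareClass_mul, add_comm]

theorem fst_discUnitHom (a : Kˣ) : (discUnitHom K a).fst = 1 := by simp [discUnitHom]

theorem snd_discUnitHom (a : Kˣ) : (discUnitHom K a).snd = signedSquareClass a := by
  simp [discUnitHom]

/-- Dimension and discriminant modulo signs as a ring homomorphism on the group ring. -/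
def groupRingDiscHom (K : Type u) [Field K] :
    MonoidAlgebra ℤ Kˣ →+* TrivSqZeroExt (ZMod 2) (SignedSquareClass K) :=
  MonoidAlgebra.liftNCRingHom (Int.castRingHom _) (discUnitHom K) fun _ _ => Commute.all _ _

theorem groupRingDiscHom_of (a : Kˣ) :
    groupRingDiscHom K (MonoidAlgebra.of ℤ Kˣ a) = discUnitHom K a := by
  simp [groupRingDiscHom]

/-- Dimension and discriminant modulo signs as a ring homomorphism on the Witt ring. -/
def discHom (hchar : (2 : K) ≠ 0) :
    WittRing K →+* TrivSqZeroExt (ZMod 2) (SignedSquareClass K) :=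
  Ideal.Quotient.lift (Ideal.span (wittRelations K)) (groupRingDiscHom K) (by
    intro x hx
    rw [← RingHom.mem_ker]
    refine (Ideal.span_le.mpr ?_) hx
    rintro y (⟨n, a, b, h, rfl⟩ | rfl)
    · obtain ⟨r, hr⟩ := exists_prod_eq_of_equivalent hchar h
      simp only [SetLike.mem_coe, RingHom.mem_ker, map_sub, map_sum, groupRingDiscHom_of]
      ext
      · simp [TrivSqZeroExt.fst_sum, fst_discUnitHom]
      · simp only [TrivSqZeroExt.snd_sub, TrivSqZeroExt.snd_sum, snd_discUnitHom,
          TrivSqZeroExt.snd_zero, ← signedSquareClass_prod, hr, signedSquareClass_mul,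
          add_sub_cancel_right]
        exact signedSquareClass_eq_zero.mpr ⟨r, Or.inl rfl⟩
    · simp only [SetLike.mem_coe, RingHom.mem_ker, map_add, groupRingDiscHom_of]
      ext
      · simp only [TrivSqZeroExt.fst_add, fst_discUnitHom, TrivSqZeroExt.fst_zero]
        decide
      · simp only [TrivSqZeroExt.snd_add, snd_discUnitHom, TrivSqZeroExt.snd_zero,
          signedSquareClass_one, zero_add]
        exact signedSquareClass_eq_zero.mpr ⟨1, Or.inr (by simp)⟩)

theorem discHom_unitClass (hchar : (2 : K) ≠ 0) (a : Kˣ) :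
    discHom hchar (unitClass a) = discUnitHom K a :=
  groupRingDiscHom_of a

theorem fst_discHom (hchar : (2 : K) ≠ 0) (x : WittRing K) :
    (discHom hchar x).fst = dimModTwo K x := by
  obtain ⟨f, rfl⟩ := mk_surjective x
  induction f using MonoidAlgebra.induction_on with
  | of a =>
    change (discHom hchar (unitClass a)).fst = dimModTwo K (unitClass a)
    rw [discHom_unitClass, fst_discUnitHom, dimModTwo_unitClass]
  | add f g hf hg => simp only [map_add, TrivSqZeroExt.fst_add, hf, hg]
  | smul r f hf => simp only [map_zsmul, TrivSqZeroExt.fst_smul, hf]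

/-- Even-dimensional classes land in the ideal of square zero. -/
theorem discHom_mul_eq_zero (hchar : (2 : K) ≠ 0) {x y : WittRing K} (hx : x ∈ fundamentalIdeal K)
    (hy : y ∈ fundamentalIdeal K) : discHom hchar (x * y) = 0 := by
  rw [fundamentalIdeal, RingHom.mem_ker, ← fst_discHom hchar] at hx hy
  rw [map_mul]
  ext <;> simp [hx, hy]

theorem discHom_eq_zero (hchar : (2 : K) ≠ 0) {x : WittRing K} (hx : x ∈ iSqPlus K) :
    discHom hchar x = 0 := by
  induction hx using AddSubgroup.closure_induction with
  | mem x hx =>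
    rcases hx with hx | rfl
    · rw [SetLike.mem_coe, pow_two] at hx
      exact Submodule.mul_induction_on hx (fun x hx y hy => discHom_mul_eq_zero hchar hx hy)
        fun x y hx hy => by rw [map_add, hx, hy, add_zero]
    · rw [map_add, discHom_unitClass, map_one]
      ext
      · simp only [TrivSqZeroExt.fst_add, TrivSqZeroExt.fst_one, TrivSqZeroExt.fst_zero]
        decide
      · simp
  | zero => exact map_zero _
  | add x y _ _ hx hy => rw [map_add, hx, hy, add_zero]
  | neg x _ hx => rw [map_neg, hx, neg_zero]

theorem discHom_sum (hchar : (2 : K) ≠ 0) (l : List Kˣ) :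
    discHom hchar (l.map unitClass).sum = TrivSqZeroExt.inl (l.length : ZMod 2) +
      TrivSqZeroExt.inr (signedSquareClass l.prod) := by
  induction l with
  | nil => ext <;> simp [signedSquareClass_one]
  | cons a l ih =>
    rw [List.map_cons, List.sum_cons, map_add, ih, discHom_unitClass]
    ext <;> simp [discUnitHom, signedSquareClass_mul, add_comm]

end Discriminant

/-- Inverses of generators are generators, `-[a] = [-a]`, so words become diagonal forms. -/
theorem WittRing.IsWordOfLength.exists_list {K : Type u} [Field K] {q : WittRing K} {n : ℕ}
    (h : IsWordOfLength q n) : ∃ l : List Kˣ, l.length = n ∧ q = (l.map unitClass).sum := by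
  obtain ⟨ε, a, rfl⟩ := h
  refine ⟨List.ofFn fun i => if ε i = 1 then a i else -a i, by simp, ?_⟩
  rw [List.map_ofFn, List.sum_ofFn]
  refine Finset.sum_congr rfl fun i _ => ?_
  rcases Int.units_eq_one_or (ε i) with h | h <;> simp [h, unitClass_neg]

end

theorem theorem6p1 {K : Type u} [Field K] [Infinite K] (hchar : (2 : K) ≠ 0)
    (g : ℕ) (hg : 1 ≤ g) :
    (∀ ρ : SurfaceGroup.{u} g →* PSL(2, K),
      bundleWittClass ρ ∈ WittRing.iSqPlus K ∧
        (WittRing.wittNorm (bundleWittClass ρ) : ℤ) ≤ 4 * ((g : ℤ) - 1) + 2) ∧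
    (∀ q ∈ WittRing.iSqPlus K, (WittRing.wittNorm q : ℤ) ≤ 4 * ((g : ℤ) - 1) →
      ∃ ρ : SurfaceGroup.{u} g →* PSL(2, K), bundleWittClass ρ = q) := by
  refine ⟨fun ρ => ⟨bundleWittClass_mem_iSqPlus ρ, ?_⟩, fun q hq hn => ?_⟩
  · have := wittNorm_bundleWittClass_le hg ρ
    omega
  · obtain ⟨n, rfl⟩ : ∃ n, g = n + 1 := ⟨g - 1, by omega⟩
    obtain ⟨l, hl, rfl⟩ := IsWordOfLength.exists_list (isWordOfLength_wittNorm q)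
    have h0 := (discHom_sum hchar l).symm.trans (discHom_eq_zero hchar hq)
    have h1 := congrArg TrivSqZeroExt.fst h0
    have h2 := congrArg TrivSqZeroExt.snd h0
    simp only [TrivSqZeroExt.fst_add, TrivSqZeroExt.snd_add, TrivSqZeroExt.fst_inl,
      TrivSqZeroExt.fst_inr, TrivSqZeroExt.snd_inl, TrivSqZeroExt.snd_inr, TrivSqZeroExt.fst_zero,
      TrivSqZeroExt.snd_zero, add_zero, zero_add, signedSquareClass_eq_zero,
      ZMod.natCast_eq_zero_iff] at h1 h2
    obtain ⟨r, hr⟩ := h2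
    -- Adding `⟨1, -1⟩` preserves the Witt class, raises the length by 2 and only changes the sign
    -- of the product.
    have key : ∀ k : ℕ, ∃ l' : List Kˣ, l'.length = l.length + 2 * k ∧
        (l'.map unitClass).sum = (l.map unitClass).sum ∧
        (l'.prod = r ^ 2 ∨ l'.prod = -r ^ 2) := by
      intro k
      induction k with
      | zero => exact ⟨l, rfl, rfl, hr⟩
      | succ k ih =>
        obtain ⟨l', h, h', h''⟩ := ih
        refine ⟨1 :: -1 :: l', by simp [h]; omega, by simp [h', unitClass_neg], ?_⟩
        rcases h'' with h'' | h'' <;> simp [h'']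
    -- The division is exact: the dimension of a class in `I²₊(K)` is even, and the length is at
    -- most `4n`.
    obtain ⟨l', h3, h4, h5⟩ := key ((4 * n - l.length) / 2)
    rw [← h4]
    exact (WittExtension.isCommProd_central n l' (by omega) r h5).exists_bundleWittClass_eq
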